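/- Let $(M,g)$ be a smooth Lorentzian manifold (signature $(-,+,\dots,+)$) of dimension $n>3$, with a smooth vector field $u$ such that $u_ku^k=-1$ and $$\nabla_i u_j=\varphi\,(g_{ij}+u_iu_j)$$ for some scalar field $\varphi$ (a shear-free, vorticity-free and acceleration-free velocity field). Let $C_{jklm}$ be the Weyl tensor, $E_{kl}=u^ju^mC_{jklm}$, and $$\Gamma_{iklm}=C_{iklm}-\frac{n-2}{n-3}\left(u_iu_mE_{kl}-u_ku_mE_{il}-u_iu_lE_{km}+u_ku_lE_{im}\right)-\frac1{n-3}\left(g_{im}E_{kl}-g_{km}E_{il}-g_{il}E_{km}+g_{kl}E_{im}\right).$$ Then $\Gamma$ is a generalized curvature tensor, i.e. $\Gamma_{jklm}=-\Gamma_{kjlm}=-\Gamma_{jkml}=\Gamma_{lmjk}$ and $\Gamma_{jklm}+\Gamma_{kljm}+\Gamma_{ljkm}=0$; it is totally traceless (the contraction of any two of its indices with $g^{-1}$ vanishes); and $$u^m\Gamma_{jklm}=0,\qquad u^p\nabla_p\Gamma_{jklm}=-2\varphi\,\Gamma_{jklm}.$$ If $n=4$, then $\Gamma_{jklm}=0$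 identically. -/

import Mathlib

open scoped Manifold ContDiff
open Bundle

namespace Spacetime

/-! ### Tensor calculus in coordinates

Tensor fields on an open part of `ℝⁿ` are given by their components, which are functions of the
coordinate point `y`. The matrix-valued function `G` is the covariant metric `g_{ij}`. -/

/-- The space of coordinates `ℝⁿ`. -/
abbrev Coord (n : ℕ) : Type := EuclideanSpace ℝ (Fin n)

/-- Partial derivative `∂_i f` at `y`. -/
noncomputable def pd {n : ℕ} (f : Coord n → ℝ) (i : Fin n) (y : Coord n) : ℝ :=
  fderiv ℝ f y (EuclideanSpace.single i 1)

/-- Inverse metric `g^{ij}`. -/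
noncomputable def gInv {n : ℕ} (G : Coord n → Matrix (Fin n) (Fin n) ℝ) (i j : Fin n)
    (y : Coord n) : ℝ :=
  (G y)⁻¹ i j

/-- Christoffel symbol of the second kind (upper index `k`, lower indices `i j`) of the
Levi-Civita connection:
`(1/2) g^{kl} (∂_i g_{jl} + ∂_j g_{il} - ∂_l g_{ij})`. -/
noncomputable def christoffel {n : ℕ} (G : Coord n → Matrix (Fin n) (Fin n) ℝ) (k i j : Fin n)
    (y : Coord n) : ℝ :=
  (1 / 2) * ∑ l, gInv G k l y *
    (pd (fun z => G z j l) i y + pd (fun z => G z i l) j y - pd (fun z => G z i j) l y)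

/-- Covariant derivative `∇_i w_j` of a covector field. -/
noncomputable def nabla1 {n : ℕ} (G : Coord n → Matrix (Fin n) (Fin n) ℝ)
    (w : Fin n → Coord n → ℝ) (i j : Fin n) (y : Coord n) : ℝ :=
  pd (w j) i y - ∑ k, christoffel G k i j y * w k y

/-- Covariant derivative `∇_p T_{jklm}` of a covariant tensor field of rank four. -/
noncomputable def nabla4 {n : ℕ} (G : Coord n → Matrix (Fin n) (Fin n) ℝ)
    (T : Fin n → Fin n → Fin n → Fin n → Coord n → ℝ) (p j k l m : Fin n) (y : Coord n) : ℝ :=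
  pd (T j k l m) p y - ∑ a, (christoffel G a p j y * T a k l m y
    + christoffel G a p k y * T j a l m y + christoffel G a p l y * T j k a m y
    + christoffel G a p m y * T j k l a y)

/-- Mixed Riemann tensor `R_{jkl}{}^m`, with the sign fixed by
`(∇_j ∇_k - ∇_k ∇_j) w_l = R_{jkl}{}^m w_m`. -/
noncomputable def riemannUp {n : ℕ} (G : Coord n → Matrix (Fin n) (Fin n) ℝ) (j k l m : Fin n)
    (y : Coord n) : ℝ :=
  pd (christoffel G m j l) k y - pd (christoffel G m k l) j y
    + ∑ p, (christoffel G p j l y * christoffel G m k p y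
      - christoffel G p k l y * christoffel G m j p y)

/-- Covariant Riemann tensor `R_{jklm}`. -/
noncomputable def riemann {n : ℕ} (G : Coord n → Matrix (Fin n) (Fin n) ℝ) (j k l m : Fin n)
    (y : Coord n) : ℝ :=
  ∑ p, riemannUp G j k l p y * G y p m

/-- Ricci tensor `R_{kl} = - R_{mkl}{}^m` (positive on round spheres). -/
noncomputable def ricci {n : ℕ} (G : Coord n → Matrix (Fin n) (Fin n) ℝ) (k l : Fin n)
    (y : Coord n) : ℝ :=
  - ∑ m, riemannUp G m k l m y

/-- Curvature scalar `R = g^{kl} R_{kl}`. -/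
noncomputable def scalarCurv {n : ℕ} (G : Coord n → Matrix (Fin n) (Fin n) ℝ) (y : Coord n) : ℝ :=
  ∑ k, ∑ l, gInv G k l y * ricci G k l y

/-- Weyl tensor `C_{jklm}`, the trace-free part of `R_{jklm}`. -/
noncomputable def weyl {n : ℕ} (G : Coord n → Matrix (Fin n) (Fin n) ℝ) (j k l m : Fin n)
    (y : Coord n) : ℝ :=
  riemann G j k l m y
    + 1 / ((n : ℝ) - 2) * (G y j m * ricci G k l y - G y k m * ricci G j l y
      + ricci G j m y * G y k l - ricci G k m y * G y j l)
    - scalarCurv G y / (((n : ℝ) - 1) * ((n : ℝ) - 2)) * (G y j m * G y k l - G y k m * G y j l)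

/-- Contravariant components `u^i = g^{ij} u_j` of a covector field `u_j`. -/
noncomputable def raise {n : ℕ} (G : Coord n → Matrix (Fin n) (Fin n) ℝ)
    (u : Fin n → Coord n → ℝ) (i : Fin n) (y : Coord n) : ℝ :=
  ∑ j, gInv G i j y * u j y

/-- Electric part `E_{kl} = u^j u^m C_{jklm}` of the Weyl tensor. -/
noncomputable def electric {n : ℕ} (G : Coord n → Matrix (Fin n) (Fin n) ℝ)
    (u : Fin n → Coord n → ℝ) (k l : Fin n) (y : Coord n) : ℝ :=
  ∑ j, ∑ m, raise G u j y * raise G u m y * weyl G j k l m y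

/-- The tensor `Γ_{iklm}`. -/
noncomputable def gammaTensor {n : ℕ} (G : Coord n → Matrix (Fin n) (Fin n) ℝ)
    (u : Fin n → Coord n → ℝ) (i k l m : Fin n) (y : Coord n) : ℝ :=
  weyl G i k l m y
    - ((n : ℝ) - 2) / ((n : ℝ) - 3) *
      (u i y * u m y * electric G u k l y - u k y * u m y * electric G u i l y
        - u i y * u l y * electric G u k m y + u k y * u l y * electric G u i m y)
    - 1 / ((n : ℝ) - 3) *
      (G y i m * electric G u k l y - G y k m * electric G u i l y
        - G y i l * electric G u k m y + G y k l * electric G u i m y)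

/-- Generalized curvature tensor: the algebraic symmetries of the Riemann tensor
(antisymmetry in each pair, exchange of the pairs, first Bianchi identity). -/
structure IsGeneralizedCurvature {n : ℕ} (T : Fin n → Fin n → Fin n → Fin n → ℝ) : Prop where
  antisymm_left : ∀ j k l m, T j k l m = - T k j l m
  antisymm_right : ∀ j k l m, T j k l m = - T j k m l
  pair_symm : ∀ j k l m, T j k l m = T l m j k
  bianchi : ∀ j k l m, T j k l m + T k l j m + T l j k m = 0

/-- Totally traceless with respect to the inverse metric `h`: the contraction of any two of the
four indices vanishes. -/
structure IsTotallyTraceless {n : ℕ} (h : Fin n → Fin n → ℝ)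
    (T : Fin n → Fin n → Fin n → Fin n → ℝ) : Prop where
  trace12 : ∀ c d, ∑ a, ∑ b, h a b * T a b c d = 0
  trace13 : ∀ c d, ∑ a, ∑ b, h a b * T a c b d = 0
  trace14 : ∀ c d, ∑ a, ∑ b, h a b * T a c d b = 0
  trace23 : ∀ c d, ∑ a, ∑ b, h a b * T c a b d = 0
  trace24 : ∀ c d, ∑ a, ∑ b, h a b * T c a d b = 0
  trace34 : ∀ c d, ∑ a, ∑ b, h a b * T c d a b = 0

/-! ### Lorentzian manifolds and their charts -/

/-- A smooth Lorentzian metric, of signature `(-,+,…,+)`, on a smooth manifold modelled on `E`. -/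
structure LorentzMetric (E : Type*) [NormedAddCommGroup E] [NormedSpace ℝ E] (M : Type*)
    [TopologicalSpace M] [ChartedSpace E M] [IsManifold 𝓘(ℝ, E) ∞ M] where
  /-- the bilinear form on each tangent space -/
  val : ∀ x : M, TangentSpace 𝓘(ℝ, E) x →L[ℝ] TangentSpace 𝓘(ℝ, E) x →L[ℝ] ℝ
  symm : ∀ (x : M) (v w : TangentSpace 𝓘(ℝ, E) x), val x v w = val x w v
  /-- there is a timelike vector whose orthogonal complement is positive definite -/
  signature : ∀ x : M, ∃ v : TangentSpace 𝓘(ℝ, E) x, val x v v < 0 ∧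
    ∀ w : TangentSpace 𝓘(ℝ, E) x, val x v w = 0 → w ≠ 0 → 0 < val x w w
  contMDiff : ContMDiff 𝓘(ℝ, E) (𝓘(ℝ, E).prod 𝓘(ℝ, E →L[ℝ] E →L[ℝ] ℝ)) ∞
    (fun x : M => TotalSpace.mk' (E →L[ℝ] E →L[ℝ] ℝ) x (val x))

/-- The tangent vector at the point with coordinates `y` whose components in the chart `e`
are `v`: the image of `v` under the differential of `e.symm` at `y`. -/
noncomputable def chartVec {E : Type*} [NormedAddCommGroup E] [NormedSpace ℝ E] {M : Type*}
    [TopologicalSpace M] [ChartedSpace E M] (e : OpenPartialHomeomorph M E) (v y : E) :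
    TangentSpace 𝓘(ℝ, E) (e.symm y) :=
  mfderiv 𝓘(ℝ, E) 𝓘(ℝ, E) e.symm y v

/-- Metric components `g_{ij} = g(∂_i, ∂_j)` in the chart `e`, as functions of the
coordinates. -/
noncomputable def LorentzMetric.comp {n : ℕ} {M : Type*} [TopologicalSpace M]
    [ChartedSpace (Coord n) M] [IsManifold (𝓡 n) ∞ M] (g : LorentzMetric (Coord n) M)
    (e : OpenPartialHomeomorph M (Coord n)) (y : Coord n) : Matrix (Fin n) (Fin n) ℝ :=
  Matrix.of fun i j => g.val (e.symm y) (chartVec e (EuclideanSpace.single i 1) y)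
    (chartVec e (EuclideanSpace.single j 1) y)

/-- Covariant components `u_j = g(u, ∂_j)` of the vector field `u` in the chart `e`. -/
noncomputable def LorentzMetric.lower {n : ℕ} {M : Type*} [TopologicalSpace M]
    [ChartedSpace (Coord n) M] [IsManifold (𝓡 n) ∞ M] (g : LorentzMetric (Coord n) M)
    (u : ∀ x : M, TangentSpace (𝓡 n) x)
    (e : OpenPartialHomeomorph M (Coord n)) (j : Fin n) (y : Coord n) : ℝ :=
  g.val (e.symm y) (u (e.symm y)) (chartVec e (EuclideanSpace.single j 1) y)

end Spacetime

set_option linter.unusedSectionVars false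

/-! Everything is local, so the statement is read in a chart, over the algebra of smooth functions
with its commuting partial derivatives. There the Levi-Civita connection is a family of matrices,
and the curvature identities become matrix identities (`MetricConnection`).

Write P = g + u⊗u. The Ricci identity applied to ∇u = φP gives R_{jklm}u^m = v_j P_{kl} - v_k P_{jl}
with v = dφ - φ²u (`sum_sharp_riem`). Tracing determines Ric(u), and it follows that the Weyl tensor
is purely electric: u^m C_{jklm} = -u_j E_{kl} + u_k E_{jl} (`sum_U_weyl`). The coefficients in Γ
are exactly those for which Γ is traceless and annihilated by u (`gamma_properties`).

For the transport equation, call a tensor of trace type if each of its terms contains the metric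
with one index from each pair, or a factor u. The second Bianchi identity, together with the
derivative of the formula for R_{jklm}u^m, shows that u^p∇_p R + 2φR is of trace type
(`isTraceType_nab4_riem`). Γ differs from R by Kulkarni–Nomizu products with g and u⊗u, so u^p∇_pΓ +
2φΓ is of trace type as well. It is also traceless, annihilated by u, and has the pair symmetries of
Γ, hence it is orthogonal to every tensor of trace type, itself included. The Lorentzian square is
indefinite, but indices may be raised with the positive definite matrix h + 2U⊗U instead: on such
tensors this preserves the orthogonality, so the tensor vanishes (`eq_zero_of_isTraceType`).

If n = 4, a frame adapted to U turns Γ into a traceless curvature tensor in three dimensions, and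
such a tensor is zero. -/

namespace Spacetime

/-! ### Smoothness and signature of the metric in a chart -/

section Charts

variable {n : ℕ} {M : Type*} [TopologicalSpace M] [ChartedSpace (Coord n) M]
  [IsManifold (𝓡 n) ∞ M] (g : LorentzMetric (Coord n) M) {e : OpenPartialHomeomorph M (Coord n)}

/-- The field is the tangent map of the inverse chart applied to a constant section. -/
lemma contMDiffOn_chartVec (he : e ∈ IsManifold.maximalAtlas (𝓡 n) ∞ M) (v : Coord n) :
    ContMDiffOn (𝓡 n) (𝓡 n).tangent ∞
      (fun y => (⟨e.symm y, chartVec e v y⟩ : TangentBundle (𝓡 n) M)) e.target := by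
  have h1 : ContMDiffOn (𝓡 n) (𝓡 n) ∞ e.symm e.target :=
    contMDiffOn_symm_of_mem_maximalAtlas he
  have h2 := h1.contMDiffOn_tangentMapWithin (m := ∞) (by simp) e.open_target.uniqueMDiffOn
  have h3 : ContMDiff (𝓡 n) (𝓡 n).tangent ∞
      (fun y : Coord n => (⟨y, v⟩ : TangentBundle (𝓡 n) (Coord n))) :=
    contMDiff_vectorSpace_iff_contDiff.2 contDiff_const
  have h4 := h2.comp (s := e.target) h3.contMDiffOn (fun y hy => hy)
  refine h4.congr fun y hy => ?_
  simp only [Function.comp, tangentMapWithin, chartVec]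
  rw [mfderivWithin_of_isOpen e.open_target hy]

lemma LorentzMetric.contDiffOn_apply (he : e ∈ IsManifold.maximalAtlas (𝓡 n) ∞ M)
    {v w : ∀ y : Coord n, TangentSpace (𝓡 n) (e.symm y)}
    (hv : ContMDiffOn (𝓡 n) (𝓡 n).tangent ∞
      (fun y => (⟨e.symm y, v y⟩ : TangentBundle (𝓡 n) M)) e.target)
    (hw : ContMDiffOn (𝓡 n) (𝓡 n).tangent ∞
      (fun y => (⟨e.symm y, w y⟩ : TangentBundle (𝓡 n) M)) e.target) :
    ContDiffOn ℝ ∞ (fun y => g.val (e.symm y) (v y) (w y)) e.target := by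
  have hg := g.contMDiff.comp_contMDiffOn (contMDiffOn_symm_of_mem_maximalAtlas he)
  have h := ContMDiffOn.clm_bundle_apply₂ (F₁ := Coord n) (F₂ := Coord n) (F₃ := ℝ)
    (E₃ := Bundle.Trivial M ℝ)
    (b := fun y => e.symm y) (ψ := fun y => g.val (e.symm y)) hg hv hw
  intro y hy
  have := h y hy
  rw [contMDiffWithinAt_totalSpace] at this
  have := this.2
  rw [contMDiffWithinAt_iff_contDiffWithinAt] at this
  simpa using this

lemma LorentzMetric.contDiffOn_comp (he : e ∈ IsManifold.maximalAtlas (𝓡 n) ∞ M) (i j : Fin n) :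
    ContDiffOn ℝ ∞ (fun y => g.comp e y i j) e.target :=
  g.contDiffOn_apply he (contMDiffOn_chartVec he _) (contMDiffOn_chartVec he _)

lemma LorentzMetric.contDiffOn_lower (he : e ∈ IsManifold.maximalAtlas (𝓡 n) ∞ M)
    {u : ∀ x : M, TangentSpace (𝓡 n) x}
    (hu : ContMDiff (𝓡 n) (𝓡 n).tangent ∞ (fun x => (⟨x, u x⟩ : TangentBundle (𝓡 n) M)))
    (j : Fin n) : ContDiffOn ℝ ∞ (g.lower u e j) e.target :=
  g.contDiffOn_apply he (v := fun y => u (e.symm y))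
    (hu.comp_contMDiffOn (contMDiffOn_symm_of_mem_maximalAtlas he)) (contMDiffOn_chartVec he _)

lemma LorentzMetric.comp_symm (e : OpenPartialHomeomorph M (Coord n)) (y : Coord n) (i j : Fin n) :
    g.comp e y i j = g.comp e y j i :=
  g.symm _ _ _

/-- The chain rule for `e ∘ e.symm`, which is the identity near `y`, gives a left inverse; equality
of dimensions does the rest. -/
lemma bijective_chartVec (he : e ∈ IsManifold.maximalAtlas (𝓡 n) ∞ M) {y : Coord n}
    (hy : y ∈ e.target) : Function.Bijective (fun v : Coord n => chartVec e v y) := by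
  have hs : MDifferentiableAt (𝓡 n) (𝓡 n) e.symm y :=
    ((contMDiffOn_symm_of_mem_maximalAtlas he).contMDiffAt
      (e.open_target.mem_nhds hy)).mdifferentiableAt (by simp)
  have ht : MDifferentiableAt (𝓡 n) (𝓡 n) e (e.symm y) :=
    ((contMDiffOn_of_mem_maximalAtlas he).contMDiffAt
      (e.open_source.mem_nhds (e.map_target hy))).mdifferentiableAt (by simp)
  have hc : mfderiv (𝓡 n) (𝓡 n) (e ∘ e.symm) y = ContinuousLinearMap.id ℝ _ := by
    have : (e ∘ e.symm) =ᶠ[nhds y] id :=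
      Filter.eventuallyEq_of_mem (e.open_target.mem_nhds hy) fun z hz => e.right_inv hz
    rw [this.mfderiv_eq]
    exact mfderiv_id
  rw [mfderiv_comp y ht hs] at hc
  have hinj : Function.Injective (fun v : Coord n => chartVec e v y) := by
    intro v w hvw
    have hL : ∀ z : Coord n, mfderiv (𝓡 n) (𝓡 n) e (e.symm y) (chartVec e z y) = z :=
      fun z => congrArg (fun L => L z) hc
    exact (hL v).symm.trans ((congrArg _ hvw).trans (hL w))
  refine ⟨hinj, ?_⟩
  let L : Coord n →ₗ[ℝ] Coord n := (mfderiv (𝓡 n) (𝓡 n) e.symm y).toLinearMap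
  exact (LinearMap.injective_iff_surjective (f := L)).1 hinj

/-- `chartVec` as a linear map in the components. -/
noncomputable def chartVecLin (e : OpenPartialHomeomorph M (Coord n)) (y : Coord n) :
    Coord n →ₗ[ℝ] TangentSpace (𝓡 n) (e.symm y) :=
  (mfderiv (𝓡 n) (𝓡 n) e.symm y).toLinearMap

lemma chartVecLin_apply (e : OpenPartialHomeomorph M (Coord n)) (y v : Coord n) :
    chartVecLin e y v = chartVec e v y := rfl

lemma chartVec_sum (e : OpenPartialHomeomorph M (Coord n)) (y : Coord n) (c : Coord n) :
    chartVec e c y = ∑ i, c i • chartVec e (EuclideanSpace.single i 1) y := by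
  have : c = ∑ i, c i • (EuclideanSpace.single i 1 : Coord n) := by
    ext j
    simp [Finset.sum_apply, Pi.single_apply]
  conv_lhs => rw [this]
  simp only [← chartVecLin_apply, map_sum, map_smul]

lemma LorentzMetric.val_chartVec (e : OpenPartialHomeomorph M (Coord n)) (y : Coord n)
    (c d : Coord n) :
    g.val (e.symm y) (chartVec e c y) (chartVec e d y)
      = ∑ i, ∑ j, c i * g.comp e y i j * d j := by
  rw [chartVec_sum e y c, chartVec_sum e y d]
  simp only [map_sum, map_smul, sum_apply, smul_apply,
    smul_eq_mul, LorentzMetric.comp, Matrix.of_apply, Finset.mul_sum]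
  rw [Finset.sum_comm]
  refine Finset.sum_congr rfl fun i _ => Finset.sum_congr rfl fun j _ => ?_
  ring

/-- In a Lorentzian vector space the orthogonal complement of a timelike vector is positive. -/
lemma LorentzMetric.pos_of_orthogonal (x : M) {t w : TangentSpace (𝓡 n) x}
    (ht : g.val x t t = -1) (htw : g.val x t w = 0) (hw : w ≠ 0) : 0 < g.val x w w := by
  obtain ⟨v, hv, hpos⟩ := g.signature x
  have ht0 : t ≠ 0 := by
    rintro rfl
    simp at ht
  by_contra hcon
  push Not at hcon
  -- If b = 0, then `t` is itself orthogonal to `v`, although g(t,t) = -1. Otherwise a t + b w is a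
  -- nonzero vector orthogonal to `v` with square -a² + b² g(w,w), which is not positive if g(w,w) ≤
  -- 0.
  set a := g.val x v w with ha
  set b := - g.val x v t with hb
  by_cases hab : b = 0
  · have := hpos t (by linarith) ht0
    linarith
  have h1 : g.val x v (a • t + b • w) = 0 := by
    simp only [map_add, map_smul, smul_eq_mul, ← ha]
    have : g.val x v t = -b := by rw [hb]; ring
    rw [this]; ring
  have h2 : a • t + b • w ≠ 0 := by
    intro h
    have h3 : g.val x t (a • t + b • w) = 0 := by rw [h]; simp
    simp only [map_add, map_smul, smul_eq_mul, ht, htw] at h3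
    have ha0 : a = 0 := by linarith
    rw [ha0] at h
    simp [hab, hw] at h
  have h3 := hpos _ h1 h2
  have hwt : g.val x w t = 0 := by rw [g.symm]; exact htw
  simp only [map_add, map_smul, smul_eq_mul, add_apply,
    smul_apply, ht, htw, hwt] at h3
  nlinarith [sq_nonneg a, mul_nonneg (sq_nonneg b) (neg_nonneg.2 hcon)]

/-- The components of a unit timelike field and of the metric at a point. -/
lemma LorentzMetric.exists_components (he : e ∈ IsManifold.maximalAtlas (𝓡 n) ∞ M)
    {u : ∀ x : M, TangentSpace (𝓡 n) x} (hu : ∀ x : M, g.val x (u x) (u x) = -1)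
    {y : Coord n} (hy : y ∈ e.target) :
    ∃ c : Fin n → ℝ, (∀ j, g.lower u e j y = ∑ i, c i * g.comp e y i j) ∧
      ∑ i, c i * g.lower u e i y = -1 ∧
      ∀ w : Fin n → ℝ, ∑ i, w i * g.lower u e i y = 0 → w ≠ 0 →
        0 < ∑ i, ∑ j, w i * g.comp e y i j * w j := by
  obtain ⟨c, hc⟩ := (bijective_chartVec he hy).2 (u (e.symm y))
  simp only at hc
  have hlow : ∀ w : Fin n → ℝ, ∑ i, w i * g.lower u e i y
      = g.val (e.symm y) (u (e.symm y)) (chartVec e (WithLp.toLp 2 w) y) := by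
    intro w
    rw [chartVec_sum]
    simp [LorentzMetric.lower]
  refine ⟨fun i => c i, fun j => ?_, ?_, fun w hw hw0 => ?_⟩
  · have := g.val_chartVec e y c (EuclideanSpace.single j 1)
    rw [hc] at this
    rw [LorentzMetric.lower, this]
    simp
  · rw [hlow]
    have : (WithLp.toLp 2 fun i => c i) = c := rfl
    rw [this, hc, hu]
  · have := g.val_chartVec e y (WithLp.toLp 2 w) (WithLp.toLp 2 w)
    simp only at this
    rw [← this]
    refine g.pos_of_orthogonal _ (hu _) (by rw [← hlow, hw]) ?_
    intro h0
    have h1 : chartVec e (WithLp.toLp 2 w) y = chartVec e 0 y := by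
      rw [h0, ← chartVecLin_apply, map_zero]
    have h2 := (bijective_chartVec he hy).1 h1
    exact hw0 (by simpa using h2)

end Charts

/-! ### The algebra of smooth functions on a coordinate domain -/

section SmoothFunctions

variable {n : ℕ} {U : TopologicalSpace.Opens (Coord n)}

/-- The algebra of smooth functions on an open set of coordinates. -/
def smoothFun (U : TopologicalSpace.Opens (Coord n)) : Subalgebra ℝ (U → ℝ) where
  carrier := {f | ∃ F : Coord n → ℝ, ContDiffOn ℝ ∞ F U ∧ ∀ x : U, F x = f x}
  mul_mem' := by
    rintro f g ⟨F, hF, hf⟩ ⟨G, hG, hg⟩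
    exact ⟨fun z => F z * G z, hF.mul hG, fun x => by simp [hf, hg]⟩
  add_mem' := by
    rintro f g ⟨F, hF, hf⟩ ⟨G, hG, hg⟩
    exact ⟨fun z => F z + G z, hF.add hG, fun x => by simp [hf, hg]⟩
  algebraMap_mem' r := ⟨fun _ => r, contDiffOn_const, fun _ => rfl⟩

/-- The smooth function on `U` given by a function of the coordinates smooth on `U`. -/
def smoothFun.mk (F : Coord n → ℝ) (hF : ContDiffOn ℝ ∞ F U) : smoothFun U :=
  ⟨fun x => F x, F, hF, fun _ => rfl⟩

/-- Evaluation at a point. -/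
def smoothFun.eval (x : U) : smoothFun U →ₐ[ℝ] ℝ :=
  (Pi.evalAlgHom ℝ (fun _ : U => ℝ) x).comp (smoothFun U).val

@[simp] lemma smoothFun.eval_mk (x : U) (F : Coord n → ℝ) (hF : ContDiffOn ℝ ∞ F U) :
    smoothFun.eval x (smoothFun.mk F hF) = F x := rfl

lemma smoothFun.ext_eval {f g : smoothFun U} (h : ∀ x, smoothFun.eval x f = smoothFun.eval x g) :
    f = g :=
  Subtype.ext (funext h)

/-- A function of the coordinates representing a smooth function on `U`. -/
noncomputable def smoothFun.rep (f : smoothFun U) : Coord n → ℝ := f.2.choose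

lemma smoothFun.contDiffOn_rep (f : smoothFun U) : ContDiffOn ℝ ∞ (smoothFun.rep f) U := f.2.choose_spec.1

lemma smoothFun.rep_apply (f : smoothFun U) (x : U) : (smoothFun.rep f) x = smoothFun.eval x f :=
  f.2.choose_spec.2 x

/-- Since `U` is open, its values determine the germ at each of its points. Hence the derivations
below do not depend on the chosen representatives. -/
lemma pd_congr {F G : Coord n → ℝ} (h : ∀ x : U, F x = G x) (i : Fin n) (x : U) :
    pd F i x = pd G i x := by
  unfold pd
  rw [Filter.EventuallyEq.fderiv_eq]
  exact Filter.eventuallyEq_of_mem (U.isOpen.mem_nhds x.2) fun z hz => h ⟨z, hz⟩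

lemma contDiffOn_pd {F : Coord n → ℝ} (hF : ContDiffOn ℝ ∞ F U) (i : Fin n) :
    ContDiffOn ℝ ∞ (pd F i) U :=
  (hF.fderiv_of_isOpen U.isOpen (by simp)).clm_apply contDiffOn_const

lemma smoothFun.differentiableAt_rep (f : smoothFun U) (x : U) : DifferentiableAt ℝ (smoothFun.rep f) x :=
  ((smoothFun.contDiffOn_rep f).contDiffAt (U.isOpen.mem_nhds x.2)).differentiableAt (by simp)

/-- The partial derivatives as derivations of the algebra of smooth functions. -/
noncomputable def smoothFun.partialDeriv (i : Fin n) : Derivation ℝ (smoothFun U) (smoothFun U) :=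
  Derivation.mk'
    { toFun := fun f => smoothFun.mk (pd (smoothFun.rep f) i) (contDiffOn_pd (smoothFun.contDiffOn_rep f) i)
      map_add' := fun f g => smoothFun.ext_eval fun x => by
        rw [map_add]
        simp only [smoothFun.eval_mk]
        rw [pd_congr (G := (smoothFun.rep f) + (smoothFun.rep g)) fun z => by simp [smoothFun.rep_apply]]
        simp [pd, fderiv_add (smoothFun.differentiableAt_rep f x) (smoothFun.differentiableAt_rep g x)]
      map_smul' := fun r f => smoothFun.ext_eval fun x => by
        rw [RingHom.id_apply, map_smul]
        simp only [smoothFun.eval_mk]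
        rw [pd_congr (G := r • (smoothFun.rep f)) fun z => by simp [smoothFun.rep_apply]]
        simp [pd, fderiv_const_smul (smoothFun.differentiableAt_rep f x)] }
    fun f g => smoothFun.ext_eval fun x => by
      simp only [LinearMap.coe_mk, AddHom.coe_mk, smul_eq_mul, map_add, map_mul,
        smoothFun.eval_mk]
      rw [pd_congr (G := (smoothFun.rep f) * (smoothFun.rep g)) fun z => by simp [smoothFun.rep_apply]]
      simp [pd, fderiv_mul (smoothFun.differentiableAt_rep f x) (smoothFun.differentiableAt_rep g x),
        smoothFun.rep_apply]

lemma smoothFun.eval_partialDeriv {F : Coord n → ℝ} {f : smoothFun U}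
    (h : ∀ x : U, F x = smoothFun.eval x f) (i : Fin n) (x : U) :
    smoothFun.eval x (smoothFun.partialDeriv i f) = pd F i x :=
  pd_congr (fun z => by rw [h, smoothFun.rep_apply]) i x

lemma smoothFun.partialDeriv_comm (i j : Fin n) (f : smoothFun U) :
    smoothFun.partialDeriv i (smoothFun.partialDeriv j f)
      = smoothFun.partialDeriv j (smoothFun.partialDeriv i f) := by
  refine smoothFun.ext_eval fun x => ?_
  have key : ∀ i j : Fin n, smoothFun.eval x (smoothFun.partialDeriv i (smoothFun.partialDeriv j f))
      = fderiv ℝ (fderiv ℝ (smoothFun.rep f)) x (EuclideanSpace.single i 1) (EuclideanSpace.single j 1) := by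
    intro i j
    rw [smoothFun.eval_partialDeriv (F := pd (smoothFun.rep f) j) fun z => rfl]
    have hd : DifferentiableAt ℝ (fderiv ℝ (smoothFun.rep f)) x :=
      ((((smoothFun.contDiffOn_rep f).fderiv_of_isOpen (m := ∞) U.isOpen (by simp)).contDiffAt
        (U.isOpen.mem_nhds x.2)).differentiableAt (by simp))
    unfold pd
    rw [fderiv_clm_apply hd (differentiableAt_const _)]
    simp
  rw [key, key]
  exact (((smoothFun.contDiffOn_rep f).contDiffAt (U.isOpen.mem_nhds x.2)).isSymmSndFDerivAt
    (by rw [minSmoothness_of_isRCLikeNormedField]; exact WithTop.coe_le_coe.2 le_top)) _ _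

end SmoothFunctions

/-! ### Derivations acting on matrices, and connections -/

section EntrywiseDerivation

open Matrix

variable {𝒜 ι κ μ : Type*} [CommRing 𝒜] [Algebra ℝ 𝒜] [Fintype ι] [Fintype κ] [Fintype μ]
  (δ : Derivation ℝ 𝒜 𝒜)

/-- The entrywise action obeys the Leibniz rule, so the curvature identities can be checked in a
noncommutative ring. -/
lemma map_derivation_mul (M : Matrix ι κ 𝒜) (N : Matrix κ μ 𝒜) :
    (M * N).map δ = M.map δ * N + M * N.map δ := by
  ext i j
  simp only [Matrix.map_apply, Matrix.mul_apply, Matrix.add_apply, map_sum, Derivation.leibniz,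
    smul_eq_mul, ← Finset.sum_add_distrib]
  exact Finset.sum_congr rfl fun k _ => by ring

lemma map_derivation_add (M N : Matrix ι κ 𝒜) : (M + N).map δ = M.map δ + N.map δ :=
  Matrix.map_add _ (map_add δ) M N

lemma map_derivation_sub (M N : Matrix ι κ 𝒜) : (M - N).map δ = M.map δ - N.map δ :=
  Matrix.map_sub _ (map_sub δ) M N

lemma map_derivation_one [DecidableEq ι] : (1 : Matrix ι ι 𝒜).map δ = 0 := by
  ext i j
  by_cases h : i = j <;> simp [h]

end EntrywiseDerivation

/-- A torsion-free metric connection in a coordinate frame, over an algebra of functions with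
commuting derivations: `A i k j` is the Christoffel symbol with upper index `k`. -/
structure MetricConnection (ι 𝒜 : Type*) [Fintype ι] [DecidableEq ι] [CommRing 𝒜]
    [Algebra ℝ 𝒜] where
  /-- coordinate derivations -/
  d : ι → Derivation ℝ 𝒜 𝒜
  d_comm : ∀ i j f, d i (d j f) = d j (d i f)
  /-- the metric -/
  g : Matrix ι ι 𝒜
  /-- the inverse metric -/
  h : Matrix ι ι 𝒜
  g_symm : ∀ i j, g i j = g j i
  g_mul_h : g * h = 1
  /-- Christoffel symbols -/
  A : ι → Matrix ι ι 𝒜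
  torsion : ∀ i j k, A i k j = A j k i
  metric : ∀ i, g.map (d i) = (A i).transpose * g + g * A i

/-! ### Curvature identities of a metric connection -/

namespace MetricConnection

open Matrix

variable {ι 𝒜 : Type*} [Fintype ι] [DecidableEq ι] [CommRing 𝒜] [Algebra ℝ 𝒜]
  (c : MetricConnection ι 𝒜)

lemma h_mul_g : c.h * c.g = 1 := mul_eq_one_comm.1 c.g_mul_h

lemma map_d_comm (i j : ι) (M : Matrix ι ι 𝒜) :
    (M.map (c.d j)).map (c.d i) = (M.map (c.d i)).map (c.d j) := by
  ext a b; exact c.d_comm _ _ _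

/-- Differentiate g h = 1 and multiply by h on the left. -/
lemma map_d_h (i : ι) : c.h.map (c.d i) = -(c.A i * c.h + c.h * (c.A i)ᵀ) := by
  have h1 := map_derivation_mul (c.d i) c.g c.h
  rw [c.g_mul_h, map_derivation_one, c.metric] at h1
  have h2 : c.h * (((c.A i)ᵀ * c.g + c.g * c.A i) * c.h + c.g * c.h.map (c.d i)) = 0 := by
    rw [← h1, mul_zero]
  have h3 : c.h * (((c.A i)ᵀ * c.g + c.g * c.A i) * c.h + c.g * c.h.map (c.d i))
      = c.h * (c.A i)ᵀ * (c.g * c.h) + (c.h * c.g) * c.A i * c.h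
        + (c.h * c.g) * c.h.map (c.d i) := by noncomm_ring
  rw [h3, c.h_mul_g, c.g_mul_h, one_mul, one_mul, mul_one] at h2
  rw [eq_neg_iff_add_eq_zero, ← h2]
  abel

/-- Curvature endomorphisms: `curv j k m l = R_{jkl}{}^m`. -/
def curv (j k : ι) : Matrix ι ι 𝒜 :=
  (c.A j).map (c.d k) - (c.A k).map (c.d j) + c.A k * c.A j - c.A j * c.A k

/-- Covariant Riemann tensor. -/
def riem (j k l m : ι) : 𝒜 := ∑ p, c.curv j k p l * c.g p m

lemma riem_eq (j k l m : ι) : c.riem j k l m = ((c.curv j k)ᵀ * c.g) l m := rfl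

lemma curv_antisymm (j k : ι) : c.curv j k = -c.curv k j := by
  unfold curv; abel

lemma riem_antisymm_left (j k l m : ι) : c.riem j k l m = -c.riem k j l m := by
  simp only [riem_eq, c.curv_antisymm j k, Matrix.transpose_neg, Matrix.neg_mul, Matrix.neg_apply]

/-- Second derivatives of the metric commute. Inserting metric compatibility twice, the terms that
survive antisymmetrization are exactly the lowered curvature. -/
lemma curv_metric (j k : ι) : (c.curv j k)ᵀ * c.g + c.g * c.curv j k = 0 := by
  have key : ∀ j k, (c.g.map (c.d j)).map (c.d k) = ((c.A j).map (c.d k))ᵀ * c.g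
      + (c.A j)ᵀ * ((c.A k)ᵀ * c.g + c.g * c.A k)
      + (((c.A k)ᵀ * c.g + c.g * c.A k) * c.A j + c.g * (c.A j).map (c.d k)) := by
    intro j k
    rw [c.metric, map_derivation_add, map_derivation_mul, map_derivation_mul, c.metric]
    rfl
  have h := c.map_d_comm k j c.g
  rw [key, key] at h
  rw [← sub_eq_zero] at h
  rw [← h]
  simp only [curv, Matrix.transpose_add, Matrix.transpose_sub, Matrix.transpose_mul]
  noncomm_ring

lemma riem_antisymm_right (j k l m : ι) : c.riem j k l m = -c.riem j k m l := by
  have h := congrFun (congrFun (c.curv_metric j k) l) m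
  rw [Matrix.add_apply, ← riem_eq, Matrix.zero_apply] at h
  have h2 : (c.g * c.curv j k) l m = c.riem j k m l := by
    simp only [Matrix.mul_apply, riem]
    exact Finset.sum_congr rfl fun p _ => by rw [c.g_symm, mul_comm]
  rw [h2] at h
  exact eq_neg_of_add_eq_zero_left h

/-- By the symmetry of the Christoffel symbols in their lower indices, both the derivative terms and
the quadratic terms cancel in pairs. -/
lemma curv_bianchi (j k l m : ι) : c.curv j k m l + c.curv k l m j + c.curv l j m k = 0 := by
  simp only [curv, Matrix.add_apply, Matrix.sub_apply, Matrix.map_apply, Matrix.mul_apply]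
  have hs : ∀ x y z, ∑ p, c.A x m p * c.A y p z = ∑ p, c.A x m p * c.A z p y :=
    fun x y z => Finset.sum_congr rfl fun p _ => by rw [c.torsion y z p]
  have hd : ∀ x y z, c.d x (c.A y m z) = c.d x (c.A z m y) := fun x y z => by rw [c.torsion y z m]
  linear_combination hs k j l + hs l k j + hs j l k + hd k j l + hd l k j + hd j l k

lemma riem_bianchi (j k l m : ι) : c.riem j k l m + c.riem k l j m + c.riem l j k m = 0 := by
  simp only [riem, ← Finset.sum_add_distrib, ← add_mul, c.curv_bianchi, zero_mul,
    Finset.sum_const_zero]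

/-- Four instances of the first Bianchi identity add up, modulo the antisymmetries, to twice the
difference; the factor 2 is cancelled by the real scalars. -/
lemma riem_pair_symm (j k l m : ι) : c.riem j k l m = c.riem l m j k := by
  have h2 : (2 : ℝ) • (c.riem j k l m - c.riem l m j k) = 0 := by
    rw [two_smul]
    linear_combination c.riem_bianchi j k l m + c.riem_bianchi k l m j - c.riem_bianchi l m j k
      - c.riem_bianchi m j k l - c.riem_antisymm_right k l m j - c.riem_antisymm_right l m k j
      - c.riem_antisymm_left m k l j + c.riem_antisymm_left m j l k - c.riem_antisymm_right j m l k
      + c.riem_antisymm_left j l m k - c.riem_antisymm_right l j m k + c.riem_antisymm_left m j k l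
      + c.riem_antisymm_right j k m l + c.riem_antisymm_right k m j l
  have := (smul_eq_zero_iff_right (two_ne_zero (α := ℝ))).1 h2
  exact sub_eq_zero.1 this

/-! ### Covariant derivatives -/

/-- `∇_i w_j`. -/
def nab1 (w : ι → 𝒜) (i j : ι) : 𝒜 := c.d i (w j) - ∑ a, c.A i a j * w a

/-- `∇_p T_{kl}`. -/
def nab2 (T : ι → ι → 𝒜) (p k l : ι) : 𝒜 :=
  c.d p (T k l) - ∑ a, (c.A p a k * T a l + c.A p a l * T k a)

/-- `∇_p T_{klm}`. -/
def nab3 (T : ι → ι → ι → 𝒜) (p k l m : ι) : 𝒜 :=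
  c.d p (T k l m) - ∑ a, (c.A p a k * T a l m + c.A p a l * T k a m + c.A p a m * T k l a)

/-- `∇_p T_{jklm}`. -/
def nab4 (T : ι → ι → ι → ι → 𝒜) (p j k l m : ι) : 𝒜 :=
  c.d p (T j k l m) - ∑ a, (c.A p a j * T a k l m + c.A p a k * T j a l m
    + c.A p a l * T j k a m + c.A p a m * T j k l a)

lemma nab2_g (p k l : ι) : c.nab2 (fun k l => c.g k l) p k l = 0 := by
  have h := congrFun (congrFun (c.metric p) k) l
  simp only [Matrix.map_apply, Matrix.add_apply, Matrix.mul_apply, Matrix.transpose_apply] at h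
  rw [nab2, h, Finset.sum_add_distrib, sub_eq_zero]
  congr 1
  exact Finset.sum_congr rfl fun a _ => mul_comm _ _

lemma nab2_add (S T : ι → ι → 𝒜) (p k l : ι) :
    c.nab2 (fun k l => S k l + T k l) p k l = c.nab2 S p k l + c.nab2 T p k l := by
  simp only [nab2, map_add, mul_add, Finset.sum_add_distrib]
  ring

lemma nab2_smul (f : 𝒜) (T : ι → ι → 𝒜) (p k l : ι) :
    c.nab2 (fun k l => f * T k l) p k l = c.d p f * T k l + f * c.nab2 T p k l := by
  simp only [nab2, Derivation.leibniz, smul_eq_mul, mul_sub, Finset.mul_sum, mul_add,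
    mul_left_comm _ f]
  ring

lemma nab2_mul (v w : ι → 𝒜) (p k l : ι) :
    c.nab2 (fun k l => v k * w l) p k l = c.nab1 v p k * w l + v k * c.nab1 w p l := by
  simp only [nab2, nab1, Derivation.leibniz, smul_eq_mul, sub_mul, mul_sub, Finset.mul_sum,
    Finset.sum_mul, Finset.sum_add_distrib, mul_left_comm _ (v k), mul_assoc]
  ring

lemma nab3_mul (v : ι → 𝒜) (T : ι → ι → 𝒜) (p k l m : ι) :
    c.nab3 (fun k l m => v k * T l m) p k l m
      = c.nab1 v p k * T l m + v k * c.nab2 T p l m := by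
  simp only [nab3, nab2, nab1, Derivation.leibniz, smul_eq_mul, sub_mul, mul_sub, Finset.mul_sum,
    Finset.sum_mul, Finset.sum_add_distrib, mul_add, mul_left_comm _ (v k), mul_assoc]
  ring

lemma nab3_swap (T : ι → ι → ι → 𝒜) (p k l m : ι) :
    c.nab3 (fun k l m => T l k m) p k l m = c.nab3 T p l k m := by
  simp only [nab3, Finset.sum_add_distrib]
  ring

lemma nab3_sub (S T : ι → ι → ι → 𝒜) (p k l m : ι) :
    c.nab3 (fun k l m => S k l m - T k l m) p k l m = c.nab3 S p k l m - c.nab3 T p k l m := by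
  simp only [nab3, map_sub, mul_sub, Finset.sum_add_distrib, Finset.sum_sub_distrib]
  ring

lemma nab4_add (S T : ι → ι → ι → ι → 𝒜) (p j k l m : ι) :
    c.nab4 (fun j k l m => S j k l m + T j k l m) p j k l m
      = c.nab4 S p j k l m + c.nab4 T p j k l m := by
  simp only [nab4, map_add, mul_add, Finset.sum_add_distrib]
  ring

lemma nab4_neg (S : ι → ι → ι → ι → 𝒜) (p j k l m : ι) :
    c.nab4 (fun j k l m => -S j k l m) p j k l m = -c.nab4 S p j k l m := by
  simp only [nab4, map_neg, mul_neg, Finset.sum_add_distrib, Finset.sum_neg_distrib]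
  ring

lemma nab4_swap_left (T : ι → ι → ι → ι → 𝒜) (p j k l m : ι) :
    c.nab4 (fun j k l m => T k j l m) p j k l m = c.nab4 T p k j l m := by
  simp only [nab4, Finset.sum_add_distrib]
  ring

lemma nab4_swap_pairs (T : ι → ι → ι → ι → 𝒜) (p j k l m : ι) :
    c.nab4 (fun j k l m => T l m j k) p j k l m = c.nab4 T p l m j k := by
  simp only [nab4, Finset.sum_add_distrib]
  ring

lemma nab4_mul (S T : ι → ι → 𝒜) (p j k l m : ι) :
    c.nab4 (fun j k l m => S j m * T k l) p j k l m
      = c.nab2 S p j m * T k l + S j m * c.nab2 T p k l := by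
  simp only [nab4, nab2, Derivation.leibniz, smul_eq_mul, sub_mul, mul_sub, Finset.mul_sum,
    Finset.sum_mul, Finset.sum_add_distrib, mul_add, add_mul, mul_left_comm _ (S j m), mul_assoc]
  ring

/-! ### Ricci and second Bianchi identities -/

/-- The Ricci identity: the Christoffel terms acting on the derivative slots cancel by vanishing
torsion, and the second partial derivatives commute. -/
lemma nab2_nab1_sub (w : ι → 𝒜) (j k l : ι) :
    c.nab2 (c.nab1 w) j k l - c.nab2 (c.nab1 w) k j l = ∑ m, c.curv j k m l * w m := by
  have hs : ∀ x y, ∑ a, ∑ b, c.A x a l * (c.A y b a * w b)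
      = ∑ b, ∑ a, c.A y b a * (c.A x a l * w b) := fun x y => by
    rw [Finset.sum_comm]
    exact Finset.sum_congr rfl fun b _ => Finset.sum_congr rfl fun a _ => by ring
  have ht : ∑ a, c.A j a k * c.nab1 w a l = ∑ a, c.A k a j * c.nab1 w a l :=
    Finset.sum_congr rfl fun a _ => by rw [c.torsion j k a]
  simp only [nab2, Finset.sum_add_distrib, ht]
  simp only [nab1, curv, map_sub, map_sum, Derivation.leibniz, smul_eq_mul, mul_sub,
    Finset.mul_sum, Finset.sum_add_distrib, Finset.sum_sub_distrib, Matrix.add_apply,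
    Matrix.sub_apply, Matrix.map_apply, Matrix.mul_apply, add_mul, sub_mul, Finset.sum_mul,
    hs, mul_assoc, mul_comm (w _)]
  linear_combination c.d_comm j k (w l)

/-- With D_i = ∂_i + A_i one has `curv j k` = [D_k, D_j], and each bracket is [D_p, `curv j k`]; the
sum is the Jacobi identity. -/
lemma curv_cyclic (p j k : ι) :
    ((c.curv j k).map (c.d p) + c.A p * c.curv j k - c.curv j k * c.A p)
      + ((c.curv k p).map (c.d j) + c.A j * c.curv k p - c.curv k p * c.A j)
      + ((c.curv p j).map (c.d k) + c.A k * c.curv p j - c.curv p j * c.A k) = 0 := by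
  simp only [curv, map_derivation_add, map_derivation_sub, map_derivation_mul]
  rw [c.map_d_comm j p (c.A k), c.map_d_comm k p (c.A j), c.map_d_comm k j (c.A p)]
  noncomm_ring

/-- Separates the endomorphism slots, where the covariant derivative is a commutator, from the slots
`j` and `k`, whose Christoffel terms cancel in the cyclic sum. -/
lemma nab4_riem (p j k l m : ι) :
    c.nab4 c.riem p j k l m
      = (((c.curv j k).map (c.d p) + c.A p * c.curv j k - c.curv j k * c.A p)ᵀ * c.g) l m
        - ∑ a, (c.A p a j * c.riem a k l m + c.A p a k * c.riem j a l m) := by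
  have h1 : c.d p (c.riem j k l m) = (((c.curv j k)ᵀ * c.g).map (c.d p)) l m := rfl
  have h2 : ∑ a, c.A p a l * c.riem j k a m = ((c.A p)ᵀ * ((c.curv j k)ᵀ * c.g)) l m := rfl
  have h3 : ∑ a, c.A p a m * c.riem j k l a = (((c.curv j k)ᵀ * c.g) * c.A p) l m :=
    Finset.sum_congr rfl fun a _ => mul_comm _ _
  have h4 : ((c.curv j k).map (c.d p) + c.A p * c.curv j k - c.curv j k * c.A p)ᵀ * c.g
      = ((c.curv j k)ᵀ * c.g).map (c.d p) - (c.A p)ᵀ * ((c.curv j k)ᵀ * c.g)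
        - (c.curv j k)ᵀ * c.g * c.A p := by
    rw [map_derivation_mul, c.metric]
    simp only [Matrix.transpose_add, Matrix.transpose_sub, Matrix.transpose_mul,
      Matrix.transpose_map]
    noncomm_ring
  rw [nab4, h4]
  simp only [Finset.sum_add_distrib, h1, h2, h3, Matrix.sub_apply]
  ring

lemma nab4_riem_bianchi (p j k l m : ι) :
    c.nab4 c.riem p j k l m + c.nab4 c.riem j k p l m + c.nab4 c.riem k p j l m = 0 := by
  have hlin : ∀ X Y Z : Matrix ι ι 𝒜, X + Y + Z = 0 →
      (Xᵀ * c.g) l m + (Yᵀ * c.g) l m + (Zᵀ * c.g) l m = 0 := fun X Y Z h => by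
    rw [← Matrix.add_apply, ← Matrix.add_apply, ← Matrix.add_mul, ← Matrix.add_mul,
      ← Matrix.transpose_add, ← Matrix.transpose_add, h, Matrix.transpose_zero, Matrix.zero_mul,
      Matrix.zero_apply]
  have h := hlin _ _ _ (c.curv_cyclic p j k)
  have hs : ∑ a, (c.A p a j * c.riem a k l m + c.A p a k * c.riem j a l m)
      + ∑ a, (c.A j a k * c.riem a p l m + c.A j a p * c.riem k a l m)
      + ∑ a, (c.A k a p * c.riem a j l m + c.A k a j * c.riem p a l m) = 0 := by
    rw [← Finset.sum_add_distrib, ← Finset.sum_add_distrib]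
    refine Finset.sum_eq_zero fun a _ => ?_
    rw [c.torsion p j a, c.torsion k j a, c.torsion p k a, c.riem_antisymm_left k a,
      c.riem_antisymm_left j a, c.riem_antisymm_left p a]
    ring
  rw [c.nab4_riem, c.nab4_riem, c.nab4_riem]
  linear_combination h - hs

/-! ### Contractions -/

/-- Leibniz rule for a contraction with a vector field: the bracket in the last sum is ∇_p U^m. -/
lemma sum_nab4_last (U : ι → 𝒜) (T : ι → ι → ι → ι → 𝒜) (p j k l : ι) :
    ∑ m, U m * c.nab4 T p j k l m = c.nab3 (fun j k l => ∑ m, U m * T j k l m) p j k l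
      - ∑ m, (c.d p (U m) + ∑ a, c.A p m a * U a) * T j k l m := by
  have hs : ∀ (X : ι → ι → 𝒜) (i : ι), ∑ m, U m * ∑ a, c.A p a i * X a m
      = ∑ a, c.A p a i * ∑ m, U m * X a m := fun X i => by
    simp only [Finset.mul_sum]
    rw [Finset.sum_comm]
    exact Finset.sum_congr rfl fun b _ => Finset.sum_congr rfl fun a _ => by ring
  have hl : ∑ m, U m * ∑ a, c.A p a m * T j k l a = ∑ m, (∑ a, c.A p m a * U a) * T j k l m := by
    simp only [Finset.mul_sum, Finset.sum_mul]
    rw [Finset.sum_comm]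
    exact Finset.sum_congr rfl fun b _ => Finset.sum_congr rfl fun a _ => by ring
  simp only [nab4, nab3, Finset.sum_add_distrib, mul_sub, mul_add, Finset.sum_sub_distrib, add_mul,
    hl, hs (fun a m => T a k l m), hs (fun a m => T j a l m), hs (fun a m => T j k a m),
    map_sum, Derivation.leibniz, smul_eq_mul, mul_comm (T j k l _)]
  ring

lemma d_h (p j m : ι) :
    c.d p (c.h j m) = -(∑ a, c.A p j a * c.h a m + ∑ a, c.A p m a * c.h j a) := by
  have h := congrFun (congrFun (c.map_d_h p) j) m
  simp only [Matrix.map_apply, Matrix.neg_apply, Matrix.add_apply, Matrix.mul_apply,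
    Matrix.transpose_apply, mul_comm (c.h j _)] at h
  exact h

/-- The inverse metric is parallel, so traces commute with the covariant derivative. -/
lemma sum_nab4_trace (T : ι → ι → ι → ι → 𝒜) (p k l : ι) :
    ∑ j, ∑ m, c.h j m * c.nab4 T p j k l m
      = c.nab2 (fun k l => ∑ j, ∑ m, c.h j m * T j k l m) p k l := by
  have hs : ∀ (X : ι → ι → ι → 𝒜) (i : ι), ∑ j, ∑ m, c.h j m * ∑ a, c.A p a i * X a j m
      = ∑ a, c.A p a i * ∑ j, ∑ m, c.h j m * X a j m := fun X i => by
    simp only [Finset.mul_sum]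
    rw [Finset.sum_congr rfl fun j _ => Finset.sum_comm, Finset.sum_comm]
    exact Finset.sum_congr rfl fun a _ => Finset.sum_congr rfl fun b _ =>
      Finset.sum_congr rfl fun j _ => by ring
  have hj : ∑ j, ∑ m, c.h j m * ∑ a, c.A p a j * T a k l m
      = ∑ j, ∑ m, (∑ a, c.A p j a * c.h a m) * T j k l m := by
    simp only [Finset.mul_sum, Finset.sum_mul]
    rw [Finset.sum_congr rfl fun j _ => Finset.sum_comm, Finset.sum_comm]
    refine Finset.sum_congr rfl fun a _ => ?_
    rw [Finset.sum_comm]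
    exact Finset.sum_congr rfl fun b _ => Finset.sum_congr rfl fun j _ => by ring
  have hm : ∑ j, ∑ m, c.h j m * ∑ a, c.A p a m * T j k l a
      = ∑ j, ∑ m, (∑ a, c.A p m a * c.h j a) * T j k l m := by
    refine Finset.sum_congr rfl fun j _ => ?_
    simp only [Finset.mul_sum, Finset.sum_mul]
    rw [Finset.sum_comm]
    exact Finset.sum_congr rfl fun b _ => Finset.sum_congr rfl fun a _ => by ring
  simp only [nab4, nab2, Finset.sum_add_distrib, mul_sub, mul_add, Finset.sum_sub_distrib, hj, hm,
    hs (fun a j m => T j a l m), hs (fun a j m => T j k a m),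
    map_sum, Derivation.leibniz, smul_eq_mul, mul_comm (T _ k l _), c.d_h, neg_mul, add_mul,
    Finset.sum_neg_distrib]
  ring

end MetricConnection

/-! ### Torse-forming covector fields -/

namespace MetricConnection

open Matrix

variable {ι 𝒜 : Type*} [Fintype ι] [DecidableEq ι] [CommRing 𝒜] [Algebra ℝ 𝒜]
  (c : MetricConnection ι 𝒜) (u : ι → 𝒜)

/-- Raised components of a covector field. -/
def sharp (i : ι) : 𝒜 := ∑ j, c.h i j * u j

/-- The tensor `g_{ij} + u_i u_j`. -/
def proj (i j : ι) : 𝒜 := c.g i j + u i * u j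

lemma proj_symm (i j : ι) : c.proj u i j = c.proj u j i := by
  rw [proj, proj, c.g_symm, mul_comm (u i)]

lemma sum_g_sharp (i : ι) : ∑ j, c.g i j * c.sharp u j = u i := by
  have h : (c.g * c.h) *ᵥ u = u := by rw [c.g_mul_h, Matrix.one_mulVec]
  rw [← Matrix.mulVec_mulVec] at h
  exact congrFun h i

lemma sum_h_g (i j : ι) : ∑ a, c.h i a * c.g j a = if i = j then 1 else 0 := by
  have h := congrFun (congrFun c.h_mul_g i) j
  rw [Matrix.mul_apply, Matrix.one_apply] at h
  rw [← h]
  exact Finset.sum_congr rfl fun a _ => by rw [c.g_symm]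

variable {u} {φ : 𝒜} (hT : ∀ i j, c.nab1 u i j = φ * c.proj u i j)
include hT

lemma nab2_proj (p k l : ι) : c.nab2 (c.proj u) p k l
    = φ * (c.proj u p k * u l + u k * c.proj u p l) := by
  have h := c.nab2_add (fun k l => c.g k l) (fun k l => u k * u l) p k l
  rw [c.nab2_g, c.nab2_mul, hT, hT] at h
  refine h.trans ?_
  ring

/-- The left side is ∇_p u^m. Raising the index of ∇u passes through the covariant derivative
because h is parallel, and h g produces the Kronecker symbol. -/
lemma nabla_sharp (p m : ι) : c.d p (c.sharp u m) + ∑ a, c.A p m a * c.sharp u a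
    = φ * ((if m = p then 1 else 0) + u p * c.sharp u m) := by
  have h1 : ∑ j, (∑ a, c.A p m a * c.h a j) * u j = ∑ a, c.A p m a * c.sharp u a := by
    simp only [sharp, Finset.mul_sum, Finset.sum_mul]
    rw [Finset.sum_comm]
    exact Finset.sum_congr rfl fun b _ => Finset.sum_congr rfl fun a _ => by ring
  have h2 : ∑ j, (∑ a, c.A p j a * c.h m a) * u j = ∑ j, c.h m j * ∑ a, c.A p a j * u a := by
    simp only [Finset.mul_sum, Finset.sum_mul]
    rw [Finset.sum_comm]
    exact Finset.sum_congr rfl fun b _ => Finset.sum_congr rfl fun a _ => by ring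
  have h3 : ∑ j, c.h m j * c.nab1 u p j
      = φ * ((if m = p then 1 else 0) + u p * c.sharp u m) := by
    rw [← c.sum_h_g m p, sharp, Finset.mul_sum, ← Finset.sum_add_distrib, Finset.mul_sum]
    exact Finset.sum_congr rfl fun j _ => by rw [hT, proj]; ring
  have h4 : c.d p (c.sharp u m) = ∑ j, c.h m j * c.d p (u j)
      - ∑ j, (∑ a, c.A p m a * c.h a j) * u j - ∑ j, (∑ a, c.A p j a * c.h m a) * u j := by
    rw [sharp, map_sum, ← Finset.sum_sub_distrib, ← Finset.sum_sub_distrib]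
    refine Finset.sum_congr rfl fun j _ => ?_
    rw [Derivation.leibniz, c.d_h, smul_eq_mul, smul_eq_mul]
    ring
  rw [← h3, h4, h1, h2]
  simp only [nab1, mul_sub, Finset.sum_sub_distrib]
  ring

/-- `R_{jkl}{}^m u_m` for a torse-forming `u`. -/
lemma sum_curv_mul (j k l : ι) : ∑ m, c.curv j k m l * u m
    = (c.d j φ - φ ^ 2 * u j) * c.proj u k l - (c.d k φ - φ ^ 2 * u k) * c.proj u j l := by
  have h : c.nab1 u = fun k l => φ * c.proj u k l := by ext i j; exact hT i j
  -- ∇_j(φP_{kl}) = ∂_jφ P_{kl} + φ²(P_{jk}u_l + u_k P_{jl}). Antisymmetrizing in j and k removes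
  -- P_{jk}, and what remains groups into dφ - φ²u.
  rw [← c.nab2_nab1_sub u, h, c.nab2_smul, c.nab2_smul, c.nab2_proj hT, c.nab2_proj hT,
    c.proj_symm u k j]
  ring

lemma sum_sharp_riem (j k l : ι) : ∑ m, c.sharp u m * c.riem j k l m
    = (c.d j φ - φ ^ 2 * u j) * c.proj u k l - (c.d k φ - φ ^ 2 * u k) * c.proj u j l := by
  rw [← c.sum_curv_mul hT]
  simp only [riem, Finset.mul_sum]
  rw [Finset.sum_comm]
  refine Finset.sum_congr rfl fun p _ => ?_
  rw [← c.sum_g_sharp u p, Finset.mul_sum]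
  exact Finset.sum_congr rfl fun m _ => by ring

/-- Covariant derivative of `u^p R_{jklp}`, in a form displaying its metric and `u` factors. -/
lemma nab4_riem_sharp (p j k l : ι) :
    ∑ m, c.sharp u m * c.nab4 c.riem p j k l m
      = c.nab1 (fun j => c.d j φ - φ ^ 2 * u j) p j * c.proj u k l
        - c.nab1 (fun j => c.d j φ - φ ^ 2 * u j) p k * c.proj u j l
        + φ * (c.d j φ - φ ^ 2 * u j) * (c.proj u p k * u l + u k * c.proj u p l)
        - φ * (c.d k φ - φ ^ 2 * u k) * (c.proj u p j * u l + u j * c.proj u p l)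
        - φ * (c.riem j k l p + u p * ((c.d j φ - φ ^ 2 * u j) * c.proj u k l
          - (c.d k φ - φ ^ 2 * u k) * c.proj u j l)) := by
  -- u^m∇_p R_{jklm} = ∇_p(u^m R_{jklm}) - (∇_p u^m)R_{jklm}. The Kronecker part of ∇_p u^m gives
  -- back the Riemann tensor with the factor -φ.
  rw [c.sum_nab4_last]
  simp only [c.nabla_sharp hT, c.sum_sharp_riem hT]
  rw [c.nab3_sub (fun j k l => (c.d j φ - φ ^ 2 * u j) * c.proj u k l)
    (fun j k l => (c.d k φ - φ ^ 2 * u k) * c.proj u j l),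
    c.nab3_swap (fun j k l => (c.d j φ - φ ^ 2 * u j) * c.proj u k l),
    c.nab3_mul (fun j => c.d j φ - φ ^ 2 * u j), c.nab3_mul (fun j => c.d j φ - φ ^ 2 * u j),
    c.nab2_proj hT, c.nab2_proj hT]
  have h : ∑ m, φ * ((if m = p then 1 else 0) + u p * c.sharp u m) * c.riem j k l m
      = φ * (c.riem j k l p + u p * ∑ m, c.sharp u m * c.riem j k l m) := by
    simp only [mul_add, add_mul, Finset.sum_add_distrib, Finset.mul_sum, mul_ite, ite_mul,
      mul_one, mul_zero, zero_mul, Finset.sum_ite_eq', Finset.mem_univ, if_true, mul_assoc]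
  rw [h, c.sum_sharp_riem hT]
  ring

end MetricConnection

/-- Tensors spanned by products of the metric or of `u` with tensors of lower rank. -/
def IsTraceType {ι 𝒜 : Type*} [CommRing 𝒜] (g : ι → ι → 𝒜) (u : ι → 𝒜)
    (T : ι → ι → ι → ι → 𝒜) : Prop :=
  ∃ (W₁ W₂ W₃ W₄ : ι → ι → 𝒜) (X₁ X₂ X₃ X₄ : ι → ι → ι → 𝒜), ∀ j k l m,
    T j k l m = g j m * W₁ k l + g j l * W₂ k m + g k m * W₃ j l + g k l * W₄ j m
      + u j * X₁ k l m + u k * X₂ j l m + u l * X₃ j k m + u m * X₄ j k l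

lemma IsTraceType.add {ι 𝒜 : Type*} [CommRing 𝒜] {g : ι → ι → 𝒜} {u : ι → 𝒜}
    {S T : ι → ι → ι → ι → 𝒜} (hS : IsTraceType g u S) (hT : IsTraceType g u T) :
    IsTraceType g u (fun j k l m => S j k l m + T j k l m) := by
  obtain ⟨a₁, a₂, a₃, a₄, b₁, b₂, b₃, b₄, h⟩ := hS
  obtain ⟨a₁', a₂', a₃', a₄', b₁', b₂', b₃', b₄', h'⟩ := hT
  refine ⟨fun x y => a₁ x y + a₁' x y, fun x y => a₂ x y + a₂' x y, fun x y => a₃ x y + a₃' x y,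
    fun x y => a₄ x y + a₄' x y, fun x y z => b₁ x y z + b₁' x y z,
    fun x y z => b₂ x y z + b₂' x y z, fun x y z => b₃ x y z + b₃' x y z,
    fun x y z => b₄ x y z + b₄' x y z, fun j k l m => ?_⟩
  simp only [h, h']
  ring

/-! ### The Riemann tensor along the flow of the torse-forming field -/

namespace MetricConnection

variable {ι 𝒜 : Type*} [Fintype ι] [DecidableEq ι] [CommRing 𝒜] [Algebra ℝ 𝒜]
  (c : MetricConnection ι 𝒜) {u : ι → 𝒜} {φ : 𝒜} (hT : ∀ i j, c.nab1 u i j = φ * c.proj u i j)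
include hT

/-- The second Bianchi identity moves the differentiation index into a curvature slot, so that u is
contracted with R and `nab4_riem_sharp` applies to both resulting terms. Each contributes -φR, which
accounts for the factor 2φ. -/
lemma isTraceType_nab4_riem : IsTraceType c.g u fun j k l m =>
    ∑ p, c.sharp u p * c.nab4 c.riem p j k l m + 2 * φ * c.riem j k l m := by
  set v : ι → 𝒜 := fun j => c.d j φ - φ ^ 2 * u j with hv
  -- The terms with P_{jk} cancel by symmetry. Each remaining term has a metric factor joining the
  -- two pairs, or a factor u_j or u_k, so the last two witnesses are zero.
  refine ⟨fun k l => c.nab1 v k l, fun k m => -c.nab1 v k m, fun j l => -c.nab1 v j l,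
    fun j m => c.nab1 v j m,
    fun k l m => c.nab1 v k l * u m - c.nab1 v k m * u l
      + 2 * φ * (v l * c.proj u m k - v m * c.proj u l k),
    fun j l m => -c.nab1 v j l * u m + c.nab1 v j m * u l
      - 2 * φ * (v l * c.proj u m j - v m * c.proj u l j), 0, 0, fun j k l m => ?_⟩
  -- Second Bianchi identity, rearranged by pair symmetry so that `p` stands in the last slot.
  have h : ∀ p, c.nab4 c.riem p j k l m
      = - c.nab4 c.riem j l m k p + c.nab4 c.riem k l m j p := by
    intro p
    have hps : c.riem = fun j k l m => c.riem l m j k := by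
      ext j k l m; exact c.riem_pair_symm _ _ _ _
    have hal : c.riem = fun j k l m => -c.riem k j l m := by
      ext j k l m; exact c.riem_antisymm_left _ _ _ _
    have h1 : ∀ q j k l m, c.nab4 c.riem q j k l m = c.nab4 c.riem q l m j k := by
      intro q j k l m
      conv_lhs => rw [hps]
      exact c.nab4_swap_pairs c.riem q j k l m
    have h2 : ∀ q j k l m, c.nab4 c.riem q j k l m = -c.nab4 c.riem q k j l m := by
      intro q j k l m
      conv_lhs => rw [hal]
      rw [c.nab4_neg (fun j k l m => c.riem k j l m)]
      rw [c.nab4_swap_left c.riem]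
    linear_combination c.nab4_riem_bianchi p j k l m - h1 j k p l m - h2 k p j l m + h1 k j p l m
  have h' : ∑ p, c.sharp u p * c.nab4 c.riem p j k l m
      = -∑ p, c.sharp u p * c.nab4 c.riem j l m k p
        + ∑ p, c.sharp u p * c.nab4 c.riem k l m j p := by
    rw [← Finset.sum_neg_distrib, ← Finset.sum_add_distrib]
    exact Finset.sum_congr rfl fun p _ => by rw [h]; ring
  beta_reduce
  rw [h', c.nab4_riem_sharp hT, c.nab4_riem_sharp hT, c.riem_pair_symm l m k j,
    c.riem_pair_symm l m j k, c.riem_antisymm_left k j]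
  simp only [← hv, proj, Pi.zero_apply]
  rw [c.g_symm m k, c.g_symm m j, c.g_symm l j, c.g_symm l k, c.g_symm k j]
  ring

end MetricConnection

section Sums

variable {ι 𝒜 : Type*} [Fintype ι] [AddCommMonoid 𝒜]

lemma sum_swap_pairs (f : ι → ι → ι → ι → 𝒜) :
    ∑ j, ∑ k, ∑ l, ∑ m, f j k l m = ∑ j, ∑ k, ∑ l, ∑ m, f l m j k := by
  rw [Finset.sum_congr rfl fun j _ => Finset.sum_comm, Finset.sum_comm]
  refine Finset.sum_congr rfl fun j _ => ?_
  rw [Finset.sum_congr rfl fun j _ => Finset.sum_comm, Finset.sum_comm]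

lemma sum_inner_first (f : ι → ι → ι → ι → 𝒜) :
    ∑ j, ∑ k, ∑ l, ∑ m, f j k l m = ∑ k, ∑ l, ∑ j, ∑ m, f j k l m := by
  rw [Finset.sum_comm]
  exact Finset.sum_congr rfl fun k _ => Finset.sum_comm

end Sums

/-- Kulkarni–Nomizu product. -/
def kn {ι 𝒜 : Type*} [CommRing 𝒜] (S T : ι → ι → 𝒜) (j k l m : ι) : 𝒜 :=
  S j m * T k l - S k m * T j l + T j m * S k l - T k m * S j l

/-! ### Tensors of trace type and their orthogonality relations -/

section TraceType

variable {ι 𝒜 : Type*} [CommRing 𝒜] {g : ι → ι → 𝒜} {u : ι → 𝒜}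

lemma IsTraceType.sum [Fintype ι] {T : ι → ι → ι → ι → ι → 𝒜} (h : ∀ p, IsTraceType g u (T p))
    (a : ι → 𝒜) : IsTraceType g u fun j k l m => ∑ p, a p * T p j k l m := by
  choose w₁ w₂ w₃ w₄ x₁ x₂ x₃ x₄ h using h
  refine ⟨fun x y => ∑ p, a p * w₁ p x y, fun x y => ∑ p, a p * w₂ p x y,
    fun x y => ∑ p, a p * w₃ p x y, fun x y => ∑ p, a p * w₄ p x y,
    fun x y z => ∑ p, a p * x₁ p x y z, fun x y z => ∑ p, a p * x₂ p x y z,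
    fun x y z => ∑ p, a p * x₃ p x y z, fun x y z => ∑ p, a p * x₄ p x y z,
    fun j k l m => ?_⟩
  simp only [Finset.mul_sum, ← Finset.sum_add_distrib, h]
  exact Finset.sum_congr rfl fun p _ => by ring

lemma IsTraceType.mul {T : ι → ι → ι → ι → 𝒜} (h : IsTraceType g u T) (a : 𝒜) :
    IsTraceType g u fun j k l m => a * T j k l m := by
  obtain ⟨w₁, w₂, w₃, w₄, x₁, x₂, x₃, x₄, h⟩ := h
  refine ⟨fun x y => a * w₁ x y, fun x y => a * w₂ x y,
    fun x y => a * w₃ x y, fun x y => a * w₄ x y,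
    fun x y z => a * x₁ x y z, fun x y z => a * x₂ x y z,
    fun x y z => a * x₃ x y z, fun x y z => a * x₄ x y z, fun j k l m => ?_⟩
  simp only [h]
  ring

lemma isTraceType_kn_metric (S : ι → ι → 𝒜) : IsTraceType g u (kn g S) :=
  ⟨S, -S, -S, S, 0, 0, 0, 0, fun j k l m => by
    simp only [kn, Pi.neg_apply, Pi.zero_apply]; ring⟩

/-- Two vectors are allowed so that the lemma covers the derivative of u⊗u, and also u⊗u itself with
a = 0 and b = u. -/
lemma isTraceType_kn_vector (a b : ι → 𝒜) (S : ι → ι → 𝒜) :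
    IsTraceType g u (kn (fun j m => a j * u m + u j * b m) S) :=
  ⟨0, 0, 0, 0, fun k l m => b m * S k l - S k m * b l, fun j l m => -(b m * S j l) + S j m * b l,
    fun j k m => S j m * a k - S k m * a j, fun j k l => a j * S k l - a k * S j l,
    fun j k l m => by simp only [kn, Pi.zero_apply]; ring⟩

lemma IsTraceType.map {ℬ : Type*} [CommRing ℬ] (f : 𝒜 →+* ℬ) {T : ι → ι → ι → ι → 𝒜}
    (h : IsTraceType g u T) : IsTraceType (fun i j => f (g i j)) (fun i => f (u i))
      (fun j k l m => f (T j k l m)) := by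
  obtain ⟨w₁, w₂, w₃, w₄, x₁, x₂, x₃, x₄, h⟩ := h
  refine ⟨fun x y => f (w₁ x y), fun x y => f (w₂ x y),
    fun x y => f (w₃ x y), fun x y => f (w₄ x y),
    fun x y z => f (x₁ x y z), fun x y z => f (x₂ x y z),
    fun x y z => f (x₃ x y z), fun x y z => f (x₄ x y z), fun j k l m => ?_⟩
  simp only [h, map_add, map_mul]

/-- A contravariant tensor with Riemann symmetries which is traceless and annihilates `u` is
orthogonal to all tensors of trace type. -/
lemma IsTraceType.sum_mul_eq_zero [Fintype ι] {F T : ι → ι → ι → ι → 𝒜} (h : IsTraceType g u T)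
    (h₁ : ∀ j k l m, F j k l m = -F k j l m) (h₂ : ∀ j k l m, F j k l m = F l m j k)
    (hu : ∀ j k l, ∑ m, u m * F j k l m = 0) (hg : ∀ k l, ∑ j, ∑ m, g j m * F j k l m = 0) :
    ∑ j, ∑ k, ∑ l, ∑ m, F j k l m * T j k l m = 0 := by
  obtain ⟨w₁, w₂, w₃, w₄, x₁, x₂, x₃, x₄, h⟩ := h
  have h₃ : ∀ j k l m, F j k l m = -F j k m l := fun j k l m => by
    rw [h₂, h₁, h₂]
  -- Only u in the last slot and g joining the outer slots are covered by hypothesis; the symmetries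
  -- of `F` carry the other six positions to these two.
  have hX₄ : ∀ X : ι → ι → ι → 𝒜, ∑ j, ∑ k, ∑ l, ∑ m, F j k l m * (u m * X j k l) = 0 := by
    intro X
    refine Finset.sum_eq_zero fun j _ => Finset.sum_eq_zero fun k _ =>
      Finset.sum_eq_zero fun l _ => ?_
    rw [← zero_mul (X j k l), ← hu j k l, Finset.sum_mul]
    exact Finset.sum_congr rfl fun m _ => by ring
  have hX₃ : ∀ X : ι → ι → ι → 𝒜, ∑ j, ∑ k, ∑ l, ∑ m, F j k l m * (u l * X j k m) = 0 := by
    intro X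
    rw [← neg_eq_zero, ← hX₄ X]
    simp only [← Finset.sum_neg_distrib]
    refine Finset.sum_congr rfl fun j _ => Finset.sum_congr rfl fun k _ => ?_
    rw [Finset.sum_comm]
    exact Finset.sum_congr rfl fun l _ => Finset.sum_congr rfl fun m _ => by rw [h₃ j k l m]; ring
  have hX₁ : ∀ X : ι → ι → ι → 𝒜, ∑ j, ∑ k, ∑ l, ∑ m, F j k l m * (u j * X k l m) = 0 := by
    intro X
    rw [sum_swap_pairs, ← hX₃ fun j k m => X m j k]
    exact Finset.sum_congr rfl fun j _ => Finset.sum_congr rfl fun k _ =>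
      Finset.sum_congr rfl fun l _ => Finset.sum_congr rfl fun m _ => by rw [h₂ j k l m]
  have hX₂ : ∀ X : ι → ι → ι → 𝒜, ∑ j, ∑ k, ∑ l, ∑ m, F j k l m * (u k * X j l m) = 0 := by
    intro X
    rw [← neg_eq_zero, ← hX₁ X]
    simp only [← Finset.sum_neg_distrib]
    rw [Finset.sum_comm]
    exact Finset.sum_congr rfl fun j _ => Finset.sum_congr rfl fun k _ =>
      Finset.sum_congr rfl fun l _ => Finset.sum_congr rfl fun m _ => by rw [h₁ j k l m]; ring
  have hW₁ : ∀ W : ι → ι → 𝒜, ∑ j, ∑ k, ∑ l, ∑ m, F j k l m * (g j m * W k l) = 0 := by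
    intro W
    rw [sum_inner_first]
    refine Finset.sum_eq_zero fun k _ => Finset.sum_eq_zero fun l _ => ?_
    rw [← zero_mul (W k l), ← hg k l, Finset.sum_mul]
    simp only [Finset.sum_mul]
    exact Finset.sum_congr rfl fun j _ => Finset.sum_congr rfl fun m _ => by ring
  have hW₂ : ∀ W : ι → ι → 𝒜, ∑ j, ∑ k, ∑ l, ∑ m, F j k l m * (g j l * W k m) = 0 := by
    intro W
    rw [← neg_eq_zero, ← hW₁ W]
    simp only [← Finset.sum_neg_distrib]
    refine Finset.sum_congr rfl fun j _ => Finset.sum_congr rfl fun k _ => ?_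
    rw [Finset.sum_comm]
    exact Finset.sum_congr rfl fun l _ => Finset.sum_congr rfl fun m _ => by rw [h₃ j k l m]; ring
  have hW₃ : ∀ W : ι → ι → 𝒜, ∑ j, ∑ k, ∑ l, ∑ m, F j k l m * (g k m * W j l) = 0 := by
    intro W
    rw [← neg_eq_zero, ← hW₁ W]
    simp only [← Finset.sum_neg_distrib]
    rw [Finset.sum_comm]
    exact Finset.sum_congr rfl fun j _ => Finset.sum_congr rfl fun k _ =>
      Finset.sum_congr rfl fun l _ => Finset.sum_congr rfl fun m _ => by rw [h₁ j k l m]; ring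
  have hW₄ : ∀ W : ι → ι → 𝒜, ∑ j, ∑ k, ∑ l, ∑ m, F j k l m * (g k l * W j m) = 0 := by
    intro W
    rw [← neg_eq_zero, ← hW₂ W]
    simp only [← Finset.sum_neg_distrib]
    rw [Finset.sum_comm]
    exact Finset.sum_congr rfl fun j _ => Finset.sum_congr rfl fun k _ =>
      Finset.sum_congr rfl fun l _ => Finset.sum_congr rfl fun m _ => by rw [h₁ j k l m]; ring
  simp only [h, mul_add, Finset.sum_add_distrib, hX₁, hX₂, hX₃, hX₄, hW₁, hW₂, hW₃, hW₄, add_zero]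

end TraceType

/-! ### Derivatives along u of tensors of trace type and of traceless tensors -/

namespace MetricConnection

variable {ι 𝒜 : Type*} [Fintype ι] [DecidableEq ι] [CommRing 𝒜] [Algebra ℝ 𝒜]
  (c : MetricConnection ι 𝒜) {u : ι → 𝒜} {φ : 𝒜}

lemma nab4_kn (S T : ι → ι → 𝒜) (p j k l m : ι) :
    c.nab4 (kn S T) p j k l m = kn (c.nab2 S p) T j k l m + kn S (c.nab2 T p) j k l m := by
  have h : kn S T = fun j k l m => (fun j k l m => (fun j k l m => S j m * T k l) j k l m
      + (fun j k l m => T j m * S k l) j k l m) j k l m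
      + (fun j k l m => -(fun j k l m => (fun j k l m => S j m * T k l) k j l m) j k l m
      + -(fun j k l m => (fun j k l m => T j m * S k l) k j l m) j k l m) j k l m := by
    ext j k l m
    simp only [kn]
    ring
  rw [h, nab4_add, nab4_add, nab4_add, nab4_neg, nab4_neg,
    c.nab4_swap_left (fun j k l m => S j m * T k l),
    c.nab4_swap_left (fun j k l m => T j m * S k l),
    nab4_mul, nab4_mul, nab4_mul, nab4_mul]
  simp only [kn]
  ring

/-- Derivative along `u` of a tensor differing from the Riemann tensor by terms of trace type. -/
lemma isTraceType_nab4 (hT : ∀ i j, c.nab1 u i j = φ * c.proj u i j) (S₁ S₂ : ι → ι → 𝒜)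
    {T : ι → ι → ι → ι → 𝒜} (h : ∀ j k l m, T j k l m = c.riem j k l m
      + (kn (fun i j => c.g i j) S₁ j k l m + kn (fun i j => u i * u j) S₂ j k l m)) :
    IsTraceType c.g u fun j k l m =>
      ∑ p, c.sharp u p * c.nab4 T p j k l m + 2 * φ * T j k l m := by
  have h1 : ∀ p, IsTraceType c.g u
      (c.nab4 (fun j k l m => kn (fun i j => c.g i j) S₁ j k l m
        + kn (fun i j => u i * u j) S₂ j k l m) p) := by
    intro p
    -- Since ∇g = 0 and ∇u = φP, differentiation keeps a factor g or u in each product. The zero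
    -- vector brings u⊗u to the shape required by `isTraceType_kn_vector`.
    have e : c.nab4 (fun j k l m => kn (fun i j => c.g i j) S₁ j k l m
        + kn (fun i j => u i * u j) S₂ j k l m) p
        = fun j k l m => kn c.g (c.nab2 S₁ p) j k l m
          + (kn (fun j m => (φ * c.proj u p j) * u m + u j * (φ * c.proj u p m)) S₂ j k l m
            + kn (fun j m => (0 : ι → 𝒜) j * u m + u j * u m) (c.nab2 S₂ p) j k l m) := by
      ext j k l m
      rw [c.nab4_add (kn (fun i j => c.g i j) S₁) (kn (fun i j => u i * u j) S₂), nab4_kn, nab4_kn]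
      simp only [kn, c.nab2_g, c.nab2_mul, hT, Pi.zero_apply]
      ring
    rw [e]
    exact (isTraceType_kn_metric _).add
      ((isTraceType_kn_vector _ _ _).add (isTraceType_kn_vector _ _ _))
  have h2 : IsTraceType c.g u fun j k l m => kn (fun i j => c.g i j) S₁ j k l m
      + kn (fun j m => (0 : ι → 𝒜) j * u m + u j * u m) S₂ j k l m :=
    (isTraceType_kn_metric _).add (isTraceType_kn_vector _ _ _)
  have h3 := (c.isTraceType_nab4_riem hT).add ((IsTraceType.sum h1 (c.sharp u)).add (h2.mul (2 * φ)))
  have hTe : T = fun j k l m => c.riem j k l m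
      + (fun j k l m => kn (fun i j => c.g i j) S₁ j k l m
        + kn (fun i j => u i * u j) S₂ j k l m) j k l m := by
    ext j k l m; exact h _ _ _ _
  refine Eq.mp (congrArg (IsTraceType c.g u) ?_) h3
  ext j k l m
  rw [hTe]
  simp only [c.nab4_add c.riem, mul_add, Finset.sum_add_distrib, Pi.zero_apply, zero_mul, zero_add]
  ring

lemma nab4_antisymm {T : ι → ι → ι → ι → 𝒜} (h : ∀ j k l m, T j k l m = -T k j l m)
    (p j k l m : ι) : c.nab4 T p j k l m = -c.nab4 T p k j l m := by
  have e : T = fun j k l m => -T k j l m := by ext j k l m; exact h _ _ _ _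
  conv_lhs => rw [e]
  rw [c.nab4_neg (fun j k l m => T k j l m), c.nab4_swap_left T]

lemma nab4_pair_symm {T : ι → ι → ι → ι → 𝒜} (h : ∀ j k l m, T j k l m = T l m j k)
    (p j k l m : ι) : c.nab4 T p j k l m = c.nab4 T p l m j k := by
  have e : T = fun j k l m => T l m j k := by ext j k l m; exact h _ _ _ _
  conv_lhs => rw [e]
  rw [c.nab4_swap_pairs T]

/-- Differentiating u^m T_{jklm} = 0 gives u^m∇_p T_{jklm} = -φT_{jklp}; a second contraction with
u, now over p, kills the right side. -/
lemma sum_sharp_nab4 (hT : ∀ i j, c.nab1 u i j = φ * c.proj u i j)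
    {T : ι → ι → ι → ι → 𝒜} (h : ∀ j k l, ∑ m, c.sharp u m * T j k l m = 0) (j k l : ι) :
    ∑ m, c.sharp u m * ∑ p, c.sharp u p * c.nab4 T p j k l m = 0 := by
  have h1 : ∀ p, ∑ m, c.sharp u m * c.nab4 T p j k l m = -(φ * T j k l p) := by
    intro p
    rw [c.sum_nab4_last]
    simp only [h, c.nabla_sharp hT]
    have : c.nab3 (fun _ _ _ => 0) p j k l = 0 := by simp [nab3]
    rw [this, zero_sub]
    congr 1
    have h2 : ∑ m, φ * ((if m = p then 1 else 0) + u p * c.sharp u m) * T j k l m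
        = φ * (T j k l p + u p * ∑ m, c.sharp u m * T j k l m) := by
      simp only [mul_add, add_mul, Finset.sum_add_distrib, Finset.mul_sum, mul_ite, ite_mul,
        mul_one, mul_zero, zero_mul, Finset.sum_ite_eq', Finset.mem_univ, if_true, mul_assoc]
    rw [h2, h]
    ring
  simp only [Finset.mul_sum]
  rw [Finset.sum_comm]
  have h3 : ∀ p, ∑ m, c.sharp u m * (c.sharp u p * c.nab4 T p j k l m)
      = -φ * (c.sharp u p * T j k l p) := fun p => by
    rw [show -φ * (c.sharp u p * T j k l p) = c.sharp u p * -(φ * T j k l p) by ring, ← h1,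
      Finset.mul_sum]
    exact Finset.sum_congr rfl fun m _ => by ring
  simp only [h3]
  rw [← Finset.mul_sum, h, mul_zero]

lemma trace_sum_sharp_nab4 {T : ι → ι → ι → ι → 𝒜}
    (h : ∀ k l, ∑ j, ∑ m, c.h j m * T j k l m = 0) (k l : ι) :
    ∑ j, ∑ m, c.h j m * ∑ p, c.sharp u p * c.nab4 T p j k l m = 0 := by
  have h1 : ∀ p, ∑ j, ∑ m, c.h j m * c.nab4 T p j k l m = 0 := by
    intro p
    rw [c.sum_nab4_trace]
    simp only [h]
    simp [nab2]
  simp only [Finset.mul_sum]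
  rw [Finset.sum_congr rfl fun j _ => Finset.sum_comm, Finset.sum_comm]
  refine Finset.sum_eq_zero fun p _ => ?_
  rw [← mul_zero (c.sharp u p), ← h1 p]
  simp only [Finset.mul_sum]
  exact Finset.sum_congr rfl fun j _ => Finset.sum_congr rfl fun m _ => by ring

end MetricConnection

/-! ### Linear transformations of rank four tensors -/

section Transform

variable {ι : Type*} [Fintype ι] [DecidableEq ι]

/-- Action of a matrix on all indices of a tensor of rank four. -/
def transform (Q : Matrix ι ι ℝ) (T : ι → ι → ι → ι → ℝ) (j k l m : ι) : ℝ :=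
  ∑ a, ∑ b, ∑ c, ∑ d, Q j a * (Q k b * (Q l c * Q m d)) * T a b c d

variable (Q : Matrix ι ι ℝ) {T : ι → ι → ι → ι → ℝ}

lemma transform_antisymm (h : ∀ j k l m, T j k l m = -T k j l m) (j k l m : ι) :
    transform Q T j k l m = -transform Q T k j l m := by
  unfold transform
  rw [Finset.sum_comm]
  simp only [← Finset.sum_neg_distrib]
  exact Finset.sum_congr rfl fun a _ => Finset.sum_congr rfl fun b _ =>
    Finset.sum_congr rfl fun c _ => Finset.sum_congr rfl fun d _ => by rw [h]; ring

lemma transform_pair_symm (h : ∀ j k l m, T j k l m = T l m j k) (j k l m : ι) :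
    transform Q T j k l m = transform Q T l m j k := by
  unfold transform
  rw [sum_swap_pairs]
  exact Finset.sum_congr rfl fun a _ => Finset.sum_congr rfl fun b _ =>
    Finset.sum_congr rfl fun c _ => Finset.sum_congr rfl fun d _ => by rw [h]; ring

lemma sum_transform_last (w : ι → ℝ)
    (h : ∀ a b c, ∑ d, (∑ m, w m * Q m d) * T a b c d = 0) (j k l : ι) :
    ∑ m, w m * transform Q T j k l m = 0 := by
  have e : ∀ m, w m * transform Q T j k l m
      = ∑ a, ∑ b, ∑ c, ∑ d, Q j a * (Q k b * Q l c) * ((w m * Q m d) * T a b c d) := fun m => by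
    simp only [transform, Finset.mul_sum]
    exact Finset.sum_congr rfl fun a _ => Finset.sum_congr rfl fun b _ =>
      Finset.sum_congr rfl fun c _ => Finset.sum_congr rfl fun d _ => by ring
  simp only [e]
  rw [Finset.sum_comm]
  refine Finset.sum_eq_zero fun a _ => ?_
  rw [Finset.sum_comm]
  refine Finset.sum_eq_zero fun b _ => ?_
  rw [Finset.sum_comm]
  refine Finset.sum_eq_zero fun c _ => ?_
  rw [Finset.sum_comm]
  simp only [← Finset.mul_sum, ← Finset.sum_mul]
  rw [h, mul_zero]

lemma sum_transform_trace (K : ι → ι → ℝ)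
    (h : ∀ b c, ∑ a, ∑ d, (∑ j, ∑ m, Q j a * K j m * Q m d) * T a b c d = 0) (k l : ι) :
    ∑ j, ∑ m, K j m * transform Q T j k l m = 0 := by
  have e : ∀ j m, K j m * transform Q T j k l m
      = ∑ b, ∑ c, ∑ a, ∑ d, (Q k b * Q l c) * ((Q j a * K j m * Q m d) * T a b c d) :=
    fun j m => by
      simp only [transform, Finset.mul_sum]
      rw [sum_inner_first]
      exact Finset.sum_congr rfl fun a _ => Finset.sum_congr rfl fun b _ =>
        Finset.sum_congr rfl fun c _ => Finset.sum_congr rfl fun d _ => by ring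
  simp only [e]
  rw [Finset.sum_congr rfl fun j _ => Finset.sum_comm, Finset.sum_comm]
  refine Finset.sum_eq_zero fun b _ => ?_
  rw [Finset.sum_congr rfl fun j _ => Finset.sum_comm, Finset.sum_comm]
  refine Finset.sum_eq_zero fun c _ => ?_
  simp only [← Finset.mul_sum]
  rw [mul_eq_zero]
  right
  rw [← h b c, sum_swap_pairs fun j m a d => Q j a * K j m * Q m d * T a b c d]
  simp only [Finset.sum_mul]

lemma eq_zero_of_transform_eq_zero {R : Matrix ι ι ℝ} (hR : R * Q = 1)
    (h : ∀ j k l m, transform Q T j k l m = 0) (j k l m : ι) : T j k l m = 0 := by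
  have key : ∀ F : ι → ℝ, (∀ j, ∑ a, Q j a * F a = 0) → ∀ a, F a = 0 := by
    intro F hF a
    have h1 : Matrix.mulVec Q F = 0 := funext hF
    have h2 : Matrix.mulVec (R * Q) F = 0 := by
      rw [← Matrix.mulVec_mulVec, h1, Matrix.mulVec_zero]
    rw [hR, Matrix.one_mulVec] at h2
    exact congrFun h2 a
  have e : ∀ j k l m, transform Q T j k l m
      = ∑ a, Q j a * ∑ b, Q k b * ∑ c, Q l c * ∑ d, Q m d * T a b c d := fun j k l m => by
    simp only [transform, Finset.mul_sum]
    exact Finset.sum_congr rfl fun a _ => Finset.sum_congr rfl fun b _ =>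
      Finset.sum_congr rfl fun c _ => Finset.sum_congr rfl fun d _ => by ring
  simp only [e] at h
  exact key _ (fun m => key _ (fun l => key _ (fun k => key _ (fun j => h j k l m) j) k) l) m

/-- The sum is the quadratic form of the fourth Kronecker power of `P`, which is again positive
definite. -/
lemma eq_zero_of_sum_transform_mul {P : Matrix ι ι ℝ} (hP : P.PosDef)
    (h : ∑ j, ∑ k, ∑ l, ∑ m, transform P T j k l m * T j k l m = 0) (j k l m : ι) :
    T j k l m = 0 := by
  have hK := hP.kronecker (hP.kronecker (hP.kronecker hP))
  by_contra hne
  set x : ι × ι × ι × ι → ℝ := fun p => T p.1 p.2.1 p.2.2.1 p.2.2.2 with hx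
  have hx0 : x ≠ 0 := fun h0 => hne (congrFun h0 (j, k, l, m))
  have := hK.dotProduct_mulVec_pos hx0
  refine this.ne' (Eq.trans ?_ h)
  simp only [dotProduct, Matrix.mulVec, Fintype.sum_prod_type, Matrix.kroneckerMap_apply, hx,
    transform, Pi.star_apply, star_trivial]
  exact Finset.sum_congr rfl fun a _ => Finset.sum_congr rfl fun b _ =>
      Finset.sum_congr rfl fun c _ => Finset.sum_congr rfl fun d _ => by rw [mul_comm]

end Transform

/-! ### Linear algebra of a Lorentzian scalar product -/

section Lorentz

/-- A Lorentzian scalar product in a basis, with a unit timelike vector `U`. -/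
structure LorentzFrame (ι : Type*) [Fintype ι] [DecidableEq ι] where
  /-- the scalar product -/
  g : Matrix ι ι ℝ
  /-- its inverse -/
  h : Matrix ι ι ℝ
  /-- the unit timelike vector -/
  U : ι → ℝ
  /-- its covariant components -/
  u : ι → ℝ
  g_symm : ∀ i j, g i j = g j i
  g_mul_h : g * h = 1
  u_eq : ∀ i, u i = ∑ j, g i j * U j
  unit : ∑ i, U i * u i = -1
  pos : ∀ w : ι → ℝ, ∑ i, w i * u i = 0 → w ≠ 0 → 0 < ∑ i, ∑ j, w i * g i j * w j

namespace LorentzFrame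

open Matrix

variable {ι : Type*} [Fintype ι] [DecidableEq ι] (L : LorentzFrame ι)

lemma h_mul_g : L.h * L.g = 1 := mul_eq_one_comm.1 L.g_mul_h

lemma h_symm (i j : ι) : L.h i j = L.h j i := by
  have hg : L.gᵀ = L.g := by ext i j; exact L.g_symm _ _
  have h1 : L.hᵀ * L.g = 1 := by
    have := congrArg Matrix.transpose L.g_mul_h
    simpa [Matrix.transpose_mul, hg] using this
  have h2 : L.hᵀ = L.h := by
    calc L.hᵀ = L.hᵀ * (L.g * L.h) := by rw [L.g_mul_h, mul_one]
      _ = L.h := by rw [← mul_assoc, h1, one_mul]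
  conv_lhs => rw [← h2]
  rfl

lemma u_eq_mulVec : L.u = L.g *ᵥ L.U := funext L.u_eq

lemma U_eq_mulVec : L.U = L.h *ᵥ L.u := by
  rw [u_eq_mulVec, Matrix.mulVec_mulVec, h_mul_g, Matrix.one_mulVec]

/-- The Riemannian inverse metric `h + 2 U ⊗ U`. -/
def wick : Matrix ι ι ℝ := L.h + (2 : ℝ) • Matrix.vecMulVec L.U L.U

lemma wick_mulVec (x : ι → ℝ) : L.wick *ᵥ x = L.h *ᵥ x + (2 * L.U ⬝ᵥ x) • L.U := by
  rw [wick, Matrix.add_mulVec, Matrix.smul_mulVec, Matrix.vecMulVec_mulVec]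
  ext i
  simp
  ring

lemma U_dotProduct_u : L.U ⬝ᵥ L.u = -1 := L.unit

lemma wick_mulVec_u : L.wick *ᵥ L.u = -L.U := by
  rw [wick_mulVec, ← U_eq_mulVec, U_dotProduct_u]
  ext i
  simp
  ring

lemma wick_transpose : L.wickᵀ = L.wick := by
  have : L.hᵀ = L.h := by ext i j; exact L.h_symm _ _
  rw [wick, Matrix.transpose_add, Matrix.transpose_smul, Matrix.transpose_vecMulVec, this]

/-- `wick` sends u to -U and agrees with h on covectors that annihilate U, so both raise the two
indices of g to the same matrix. Hence tracelessness survives raising all indices with `wick`. -/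
lemma wick_mul_g_mul_wick : L.wick * L.g * L.wick = L.h := by
  have h1 : L.U ᵥ* L.g = L.u := by
    rw [u_eq_mulVec, ← Matrix.mulVec_transpose]
    congr 1
    ext i j; exact L.g_symm _ _
  have h2 : L.u ᵥ* L.wick = -L.U := by
    rw [← Matrix.mulVec_transpose, wick_transpose, wick_mulVec_u]
  have h3 : L.wick * L.g = 1 + (2 : ℝ) • Matrix.vecMulVec L.U L.u := by
    rw [wick, add_mul, h_mul_g, Matrix.smul_mul, Matrix.vecMulVec_mul, h1]
  rw [h3, add_mul, one_mul, Matrix.smul_mul, Matrix.vecMulVec_mul, h2, wick]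
  ext i j
  simp [Matrix.vecMulVec_apply]

/-- Let x be the raised covector and s = x·u. Then x + sU is orthogonal to U, and the form equals
g(x + sU, x + sU) + s². -/
lemma wick_posDef : L.wick.PosDef := by
  refine Matrix.PosDef.of_dotProduct_mulVec_pos ?_ fun ξ hξ => ?_
  · rw [Matrix.IsHermitian, Matrix.conjTranspose_eq_transpose_of_trivial, wick_transpose]
  set x := L.h *ᵥ ξ with hx
  have hgx : L.g *ᵥ x = ξ := by
    rw [hx, Matrix.mulVec_mulVec, g_mul_h, Matrix.one_mulVec]
  have hgt : L.gᵀ = L.g := by ext i j; exact L.g_symm _ _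
  have hUξ : L.U ⬝ᵥ ξ = x ⬝ᵥ L.u := by
    rw [← hgx, Matrix.dotProduct_mulVec, ← Matrix.mulVec_transpose, hgt, ← u_eq_mulVec,
      dotProduct_comm]
  set s := x ⬝ᵥ L.u with hs
  have hq : ∀ w : ι → ℝ, ∑ i, ∑ j, w i * L.g i j * w j = w ⬝ᵥ (L.g *ᵥ w) := fun w => by
    simp only [dotProduct, Matrix.mulVec, Finset.mul_sum, mul_assoc]
  have hw : (x + s • L.U) ⬝ᵥ L.u = 0 := by
    rw [add_dotProduct, smul_dotProduct, U_dotProduct_u, ← hs]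
    simp
  have hval : star ξ ⬝ᵥ (L.wick *ᵥ ξ)
      = (x + s • L.U) ⬝ᵥ (L.g *ᵥ (x + s • L.U)) + s ^ 2 := by
    rw [Matrix.mulVec_add, Matrix.mulVec_smul, hgx, ← u_eq_mulVec, dotProduct_add,
      dotProduct_smul, hw, wick_mulVec, ← hx, add_dotProduct, smul_dotProduct, hUξ, star_trivial,
      dotProduct_add, dotProduct_smul, dotProduct_comm ξ L.U, hUξ,
      dotProduct_comm ξ x]
    simp only [smul_eq_mul]
    ring
  rw [hval]
  by_cases h0 : x + s • L.U = 0
  · rw [h0, zero_dotProduct, zero_add]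
    have : s ≠ 0 := by
      intro hs0
      rw [hs0, zero_smul, add_zero] at h0
      rw [h0, Matrix.mulVec_zero] at hgx
      exact hξ hgx.symm
    positivity
  · have := L.pos _ hw h0
    rw [hq] at this
    positivity

/-- A traceless tensor with Riemann symmetries annihilated by `U` is zero if it is of trace
type. -/
lemma eq_zero_of_isTraceType {T : ι → ι → ι → ι → ℝ} (h : IsTraceType L.g L.u T)
    (h₁ : ∀ j k l m, T j k l m = -T k j l m) (h₂ : ∀ j k l m, T j k l m = T l m j k)
    (hu : ∀ j k l, ∑ m, L.U m * T j k l m = 0) (ht : ∀ k l, ∑ j, ∑ m, L.h j m * T j k l m = 0)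
    (j k l m : ι) : T j k l m = 0 := by
  -- Raise all four indices of `T` with `wick`. The result is annihilated by u since `wick` u = -U,
  -- and is traceless against g, so it is orthogonal to the trace-type `T`: the Euclidean square of
  -- `T` is zero.
  refine eq_zero_of_sum_transform_mul L.wick_posDef (h.sum_mul_eq_zero
    (transform_antisymm _ h₁) (transform_pair_symm _ h₂)
    (sum_transform_last _ _ fun a b c => ?_) (sum_transform_trace _ _ fun b c => ?_)) j k l m
  · have e : ∀ d, ∑ m, L.u m * L.wick m d = -L.U d := fun d => by
      have := congrFun L.wick_mulVec_u d
      rw [← L.wick_transpose] at this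
      rw [← Pi.neg_apply, ← this]
      exact Finset.sum_congr rfl fun m _ => mul_comm _ _
    simp only [e, neg_mul, Finset.sum_neg_distrib, hu, neg_zero]
  · have e : ∀ a d, ∑ j, ∑ m, L.wick j a * L.g j m * L.wick m d = L.h a d := fun a d => by
      rw [← L.wick_mul_g_mul_wick, Matrix.mul_apply, Finset.sum_comm]
      refine Finset.sum_congr rfl fun m _ => ?_
      rw [Matrix.mul_apply, Finset.sum_mul]
      refine Finset.sum_congr rfl fun j _ => ?_
      rw [show L.wick a j = L.wick j a from congrFun (congrFun L.wick_transpose j) a]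
    simp only [e, ht]

end LorentzFrame
end Lorentz

open scoped MatrixOrder in
/-- An orthonormal frame of the Riemannian metric attached to `U`, containing `U`. -/
lemma LorentzFrame.exists_adapted_frame {ι : Type*} [Fintype ι] [DecidableEq ι]
    (L : LorentzFrame ι) (i₀ : ι) : ∃ Q : Matrix ι ι ℝ, Q.transpose * Q = L.wick ∧ Q i₀ = L.U := by
  -- Factor `wick` = CᵀC. Then β = -Cu is a unit vector with Cᵀβ = U. Completing β to the rows of an
  -- orthogonal O, the matrix Q = OC still satisfies QᵀQ = `wick`, and its row i₀ is Cᵀβ.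
  obtain ⟨C, hC⟩ := CStarAlgebra.nonneg_iff_eq_star_mul_self.mp L.wick_posDef.posSemidef.nonneg
  rw [Matrix.star_eq_conjTranspose, Matrix.conjTranspose_eq_transpose_of_trivial] at hC
  set β : ι → ℝ := -(C.mulVec L.u) with hβ
  have h1 : C.transpose.mulVec β = L.U := by
    rw [hβ, Matrix.mulVec_neg, Matrix.mulVec_mulVec, ← hC, L.wick_mulVec_u, neg_neg]
  have h2 : dotProduct β β = 1 := by
    have : dotProduct β β = -dotProduct L.U L.u := by
      conv_lhs => rw [hβ, dotProduct_neg, ← hβ, Matrix.dotProduct_mulVec, ← Matrix.mulVec_transpose,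
        h1]
    rw [this, L.U_dotProduct_u, neg_neg]
  have hon : Orthonormal ℝ (({i₀} : Set ι).domRestrict
      fun _ : ι => (WithLp.toLp 2 β : EuclideanSpace ℝ ι)) := by
    constructor
    · intro i
      have : ‖(WithLp.toLp 2 β : EuclideanSpace ℝ ι)‖ ^ 2 = 1 := by
        rw [EuclideanSpace.real_norm_sq_eq, ← h2]
        exact Finset.sum_congr rfl fun i _ => by simp [sq]
      exact (pow_eq_one_iff_of_nonneg (norm_nonneg _) two_ne_zero).1 this
    · intro i j hij
      exact absurd (Subsingleton.elim i j) hij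
  obtain ⟨b, hb⟩ := hon.exists_orthonormalBasis_extension_of_card_eq (by simp)
  have hb0 : b i₀ = WithLp.toLp 2 β := hb i₀ rfl
  set O : Matrix ι ι ℝ := Matrix.of fun i j => b i j with hO
  have hOO : O * O.transpose = 1 := by
    ext i j
    have := orthonormal_iff_ite.1 b.orthonormal i j
    rw [Matrix.mul_apply, Matrix.one_apply, ← this]
    simp only [PiLp.inner_apply, hO, Matrix.transpose_apply, Matrix.of_apply]
    exact Finset.sum_congr rfl fun k _ => by simp [mul_comm]
  refine ⟨O * C, ?_, ?_⟩
  · rw [Matrix.transpose_mul, Matrix.mul_assoc, ← Matrix.mul_assoc O.transpose,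
      mul_eq_one_comm.1 hOO, Matrix.one_mul, ← hC]
  · rw [← h1, Matrix.mulVec_transpose]
    ext j
    rw [Matrix.mul_apply]
    simp [hO, hb0, Matrix.vecMul, dotProduct]

/-- In three dimensions a traceless tensor with Riemann symmetries vanishes. -/
lemma eq_zero_of_traceless_of_annihilate_zero {T : Fin 4 → Fin 4 → Fin 4 → Fin 4 → ℝ}
    (h₁ : ∀ j k l m, T j k l m = -T k j l m) (h₂ : ∀ j k l m, T j k l m = T l m j k)
    (h₀ : ∀ j k l, T j k l 0 = 0) (ht : ∀ k l, ∑ j, T j k l j = 0) (j k l m : Fin 4) :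
    T j k l m = 0 := by
  have h₃ : ∀ j k l m, T j k l m = -T j k m l := fun j k l m => by rw [h₂, h₁, h₂]
  have h₀' : ∀ j k l, T j k 0 l = 0 := fun j k l => by rw [h₃, h₀, neg_zero]
  have hd : ∀ j l m, T j j l m = 0 := fun j l m => by linarith [h₁ j j l m]
  have hd' : ∀ j k l, T j k l l = 0 := fun j k l => by linarith [h₃ j k l l]
  have z : ∀ k l m, T 0 k l m = 0 := fun k l m => by rw [h₂, h₀']
  simp only [Fin.sum_univ_four, h₀, zero_add] at ht
  have a₁ := ht 1 1
  have a₂ := ht 2 2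
  have a₃ := ht 3 3
  have a₄ := ht 1 2
  have a₅ := ht 1 3
  have a₆ := ht 2 3
  simp only [hd, hd', zero_add, add_zero] at a₁ a₂ a₃ a₄ a₅ a₆
  -- The three diagonal traces make the pairwise sums of the three sectional components vanish,
  -- hence each of them; every off-diagonal trace reduces to a single mixed component.
  have c₁ : T 1 2 1 2 = 0 := by
    linarith [h₁ 2 1 1 2, h₃ 1 2 2 1, h₁ 3 1 1 3, h₃ 1 3 3 1, h₁ 3 2 2 3, h₃ 2 3 3 2]
  have c₂ : T 1 3 1 3 = 0 := by
    linarith [h₁ 2 1 1 2, h₃ 1 2 2 1, h₁ 3 1 1 3, h₃ 1 3 3 1, h₁ 3 2 2 3, h₃ 2 3 3 2]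
  have c₃ : T 2 3 2 3 = 0 := by
    linarith [h₁ 2 1 1 2, h₃ 1 2 2 1, h₁ 3 1 1 3, h₃ 1 3 3 1, h₁ 3 2 2 3, h₃ 2 3 3 2]
  have c₄ : T 1 3 2 3 = 0 := by linarith [h₁ 3 1 2 3]
  have c₅ : T 1 2 2 3 = 0 := by linarith [h₁ 2 1 3 2, h₃ 1 2 3 2]
  have c₆ : T 1 2 1 3 = 0 := by linarith [h₃ 1 2 3 1]
  have c₄' := h₂ 2 3 1 3
  have c₅' := h₂ 2 3 1 2
  have c₆' := h₂ 1 3 1 2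
  rw [c₄] at c₄'
  rw [c₅] at c₅'
  rw [c₆] at c₆'
  have d₁ : ∀ l m, T 1 2 l m = 0 := fun l m => by
    fin_cases l <;> fin_cases m <;>
      first
        | exact h₀ _ _ _ | exact h₀' _ _ _ | exact hd' _ _ _ | assumption
        | (refine (h₃ _ _ _ _).trans (neg_eq_zero.2 ?_); assumption)
  have d₂ : ∀ l m, T 1 3 l m = 0 := fun l m => by
    fin_cases l <;> fin_cases m <;>
      first
        | exact h₀ _ _ _ | exact h₀' _ _ _ | exact hd' _ _ _ | assumption
        | (refine (h₃ _ _ _ _).trans (neg_eq_zero.2 ?_); assumption)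
  have d₃ : ∀ l m, T 2 3 l m = 0 := fun l m => by
    fin_cases l <;> fin_cases m <;>
      first
        | exact h₀ _ _ _ | exact h₀' _ _ _ | exact hd' _ _ _ | assumption
        | (refine (h₃ _ _ _ _).trans (neg_eq_zero.2 ?_); assumption)
  have z' : ∀ j l m, T j 0 l m = 0 := fun j l m => by rw [h₁, z, neg_zero]
  fin_cases j <;> fin_cases k <;>
    first
      | exact z _ _ _ | exact z' _ _ _ | exact hd _ _ _
      | exact d₁ _ _ | exact d₂ _ _ | exact d₃ _ _
      | (refine (h₁ _ _ _ _).trans (neg_eq_zero.2 ?_)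
         first | exact d₁ _ _ | exact d₂ _ _ | exact d₃ _ _)

/-- In the adapted frame index 0 is the direction U, which annihilates `T`. The term 2U⊗U therefore
does not affect the trace, so the h-trace becomes the Euclidean trace on the other three indices. -/
lemma LorentzFrame.eq_zero_of_dim_four (L : LorentzFrame (Fin 4))
    {T : Fin 4 → Fin 4 → Fin 4 → Fin 4 → ℝ}
    (h₁ : ∀ j k l m, T j k l m = -T k j l m) (h₂ : ∀ j k l m, T j k l m = T l m j k)
    (hu : ∀ j k l, ∑ m, L.U m * T j k l m = 0) (ht : ∀ k l, ∑ j, ∑ m, L.h j m * T j k l m = 0)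
    (j k l m : Fin 4) : T j k l m = 0 := by
  obtain ⟨Q, hQ, hQ0⟩ := L.exists_adapted_frame 0
  have hinv : L.wick⁻¹ * Q.transpose * Q = 1 := by
    rw [Matrix.mul_assoc, hQ]
    exact Matrix.nonsing_inv_mul _ ((Matrix.isUnit_iff_isUnit_det _).1 L.wick_posDef.isUnit)
  refine eq_zero_of_transform_eq_zero Q hinv (eq_zero_of_traceless_of_annihilate_zero
    (transform_antisymm Q h₁) (transform_pair_symm Q h₂) (fun j k l => ?_) fun k l => ?_) j k l m
  · have := sum_transform_last (T := T) Q (Pi.single 0 1) (fun a b c => by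
      rw [← hu a b c]
      simp [Pi.single_apply, hQ0]) j k l
    simpa [Pi.single_apply] using this
  · have hq : ∀ a d, ∑ j, Q j a * Q j d = L.h a d + 2 * (L.U a * L.U d) := fun a d => by
      have : (Q.transpose * Q) a d = L.wick a d := by rw [hQ]
      simpa [Matrix.mul_apply, LorentzFrame.wick, Matrix.vecMulVec_apply] using this
    have := sum_transform_trace (T := T) Q (1 : Matrix (Fin 4) (Fin 4) ℝ) (fun b c => by
      have e : ∀ a d, ∑ j, ∑ m, Q j a * (1 : Matrix (Fin 4) (Fin 4) ℝ) j m * Q m d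
          = L.h a d + 2 * (L.U a * L.U d) := fun a d => by
        rw [← hq]
        exact Finset.sum_congr rfl fun j _ => by simp [Matrix.one_apply]
      simp only [e]
      simp only [add_mul, Finset.sum_add_distrib, ht, zero_add, mul_assoc, ← Finset.mul_sum, hu,
        mul_zero, Finset.sum_const_zero]) k l
    simpa [Matrix.one_apply] using this

/-! ### Kulkarni–Nomizu products and generalized curvature tensors -/

section KulkarniNomizu

variable {n : ℕ} {T T' : Fin n → Fin n → Fin n → Fin n → ℝ} {S S' : Fin n → Fin n → ℝ}

lemma IsGeneralizedCurvature.add (h : IsGeneralizedCurvature T) (h' : IsGeneralizedCurvature T') :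
    IsGeneralizedCurvature fun j k l m => T j k l m + T' j k l m where
  antisymm_left j k l m := by linarith [h.antisymm_left j k l m, h'.antisymm_left j k l m]
  antisymm_right j k l m := by linarith [h.antisymm_right j k l m, h'.antisymm_right j k l m]
  pair_symm j k l m := by linarith [h.pair_symm j k l m, h'.pair_symm j k l m]
  bianchi j k l m := by linarith [h.bianchi j k l m, h'.bianchi j k l m]

lemma IsGeneralizedCurvature.congr (h : IsGeneralizedCurvature T)
    (e : ∀ j k l m, T' j k l m = T j k l m) : IsGeneralizedCurvature T' where
  antisymm_left j k l m := by rw [e, e, h.antisymm_left]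
  antisymm_right j k l m := by rw [e, e, h.antisymm_right]
  pair_symm j k l m := by rw [e, e, h.pair_symm]
  bianchi j k l m := by rw [e, e, e, h.bianchi]

lemma isGeneralizedCurvature_kn (h : ∀ i j, S i j = S j i) (h' : ∀ i j, S' i j = S' j i) :
    IsGeneralizedCurvature (kn S S') where
  antisymm_left j k l m := by simp only [kn]; ring
  antisymm_right j k l m := by simp only [kn]; ring
  pair_symm j k l m := by
    simp only [kn]; rw [h m j, h' k l, h m k, h' j l, h' m j, h k l, h' m k, h j l]; ring
  bianchi j k l m := by
    simp only [kn]; rw [h' k l, h' j k, h' j l, h k l, h j l, h j k]; ring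

/-- For a generalized curvature tensor all contractions are determined by one of them. -/
lemma IsGeneralizedCurvature.isTotallyTraceless (h : IsGeneralizedCurvature T)
    {H : Fin n → Fin n → ℝ} (hH : ∀ i j, H i j = H j i)
    (ht : ∀ k l, ∑ j, ∑ m, H j m * T j k l m = 0) : IsTotallyTraceless H T where
  trace12 c d := by
    have e : ∑ a, ∑ b, H a b * T a b c d = -∑ a, ∑ b, H a b * T a b c d := by
      conv_lhs => rw [Finset.sum_comm]
      simp only [← Finset.sum_neg_distrib]
      exact Finset.sum_congr rfl fun a _ => Finset.sum_congr rfl fun b _ => by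
        rw [hH, h.antisymm_left]; ring
    linarith
  trace13 c d := by
    rw [← neg_eq_zero, ← ht c d]
    simp only [← Finset.sum_neg_distrib]
    exact Finset.sum_congr rfl fun a _ => Finset.sum_congr rfl fun b _ => by
      rw [h.antisymm_right a c b d]; ring
  trace14 c d := ht c d
  trace23 c d := by
    rw [← ht c d]
    exact Finset.sum_congr rfl fun a _ => Finset.sum_congr rfl fun b _ => by
      rw [h.antisymm_left c a b d, h.antisymm_right a c b d]; ring
  trace24 c d := by
    rw [← neg_eq_zero, ← ht c d]
    simp only [← Finset.sum_neg_distrib]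
    exact Finset.sum_congr rfl fun a _ => Finset.sum_congr rfl fun b _ => by
      rw [h.antisymm_left c a d b]; ring
  trace34 c d := by
    have e : ∑ a, ∑ b, H a b * T c d a b = -∑ a, ∑ b, H a b * T c d a b := by
      conv_lhs => rw [Finset.sum_comm]
      simp only [← Finset.sum_neg_distrib]
      exact Finset.sum_congr rfl fun a _ => Finset.sum_congr rfl fun b _ => by
        rw [hH, h.antisymm_right]; ring
    linarith

end KulkarniNomizu

/-! ### Contractions, the Weyl tensor and its electric part at a point -/

namespace LorentzFrame

variable {n : ℕ} (L : LorentzFrame (Fin n))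

lemma u_eq' (i : Fin n) : ∑ j, L.U j * L.g i j = L.u i := by
  rw [L.u_eq]
  exact Finset.sum_congr rfl fun j _ => mul_comm _ _

lemma U_eq (i : Fin n) : L.U i = ∑ j, L.h i j * L.u j := by
  conv_lhs => rw [L.U_eq_mulVec]
  rfl

lemma sum_h_mul_g (i j : Fin n) : ∑ a, L.h i a * L.g j a = if i = j then 1 else 0 := by
  have h := congrFun (congrFun L.h_mul_g i) j
  rw [Matrix.mul_apply, Matrix.one_apply] at h
  rw [← h]
  exact Finset.sum_congr rfl fun a _ => by rw [L.g_symm]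

lemma trace_g : ∑ j, ∑ m, L.h j m * L.g j m = n := by
  simp [sum_h_mul_g]

lemma trace_g_mul (S : Fin n → ℝ) (k : Fin n) : ∑ j, ∑ m, L.h j m * (L.g k m * S j) = S k := by
  have e : ∀ j, ∑ m, L.h j m * (L.g k m * S j) = (if j = k then 1 else 0) * S j := fun j => by
    rw [← L.sum_h_mul_g, Finset.sum_mul]
    exact Finset.sum_congr rfl fun m _ => by ring
  simp [e]

lemma trace_mul_g (S : Fin n → ℝ) (l : Fin n) : ∑ j, ∑ m, L.h j m * (S m * L.g j l) = S l := by
  rw [Finset.sum_comm, ← L.trace_g_mul S l]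
  exact Finset.sum_congr rfl fun a _ => Finset.sum_congr rfl fun b _ => by
    rw [L.h_symm, L.g_symm]; ring

lemma trace_u_mul (S : Fin n → ℝ) : ∑ j, ∑ m, L.h j m * (L.u m * S j) = ∑ j, L.U j * S j := by
  refine Finset.sum_congr rfl fun j _ => ?_
  rw [U_eq, Finset.sum_mul]
  exact Finset.sum_congr rfl fun m _ => by ring

lemma trace_u_mul_u : ∑ j, ∑ m, L.h j m * (L.u j * L.u m) = -1 := by
  rw [← L.unit, ← L.trace_u_mul]
  exact Finset.sum_congr rfl fun m _ => Finset.sum_congr rfl fun m _ => by ring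

variable {S : Fin n → Fin n → ℝ}

lemma trace_kn_g (S : Fin n → Fin n → ℝ) (k l : Fin n) :
    ∑ j, ∑ m, L.h j m * kn L.g S j k l m
      = (n - 2) * S k l + (∑ j, ∑ m, L.h j m * S j m) * L.g k l := by
  have e : ∑ j, ∑ m, L.h j m * kn L.g S j k l m
      = (∑ j, ∑ m, L.h j m * L.g j m) * S k l - ∑ j, ∑ m, L.h j m * (L.g k m * S j l)
        + (∑ j, ∑ m, L.h j m * S j m) * L.g k l - ∑ j, ∑ m, L.h j m * (S k m * L.g j l) := by
    simp only [Finset.sum_mul, ← Finset.sum_sub_distrib, ← Finset.sum_add_distrib, kn]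
    exact Finset.sum_congr rfl fun m _ => Finset.sum_congr rfl fun m _ => by ring
  rw [e, trace_g, L.trace_g_mul (fun j => S j l), L.trace_mul_g (S k)]
  ring

lemma trace_kn_u (hS : ∀ i j, S i j = S j i) (hU : ∀ i, ∑ j, L.U j * S i j = 0) (k l : Fin n) :
    ∑ j, ∑ m, L.h j m * kn (fun i j => L.u i * L.u j) S j k l m
      = -S k l + (∑ j, ∑ m, L.h j m * S j m) * (L.u k * L.u l) := by
  have e : ∑ j, ∑ m, L.h j m * kn (fun i j => L.u i * L.u j) S j k l m
      = (∑ j, ∑ m, L.h j m * (L.u j * L.u m)) * S k l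
        - (∑ j, ∑ m, L.h j m * (L.u m * S j l)) * L.u k
        + (∑ j, ∑ m, L.h j m * S j m) * (L.u k * L.u l)
        - (∑ m, ∑ j, L.h m j * (L.u j * S k m)) * L.u l := by
    rw [Finset.sum_comm (f := fun m j => L.h m j * (L.u j * S k m))]
    simp only [Finset.sum_mul, ← Finset.sum_sub_distrib, ← Finset.sum_add_distrib, kn]
    exact Finset.sum_congr rfl fun j _ => Finset.sum_congr rfl fun m _ => by
      rw [L.h_symm m j]; ring
  have h1 : ∑ j, L.U j * S j l = 0 := by
    rw [← hU l]
    exact Finset.sum_congr rfl fun j _ => by rw [hS]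
  rw [e, trace_u_mul_u, trace_u_mul, trace_u_mul, hU, h1]
  ring

lemma sum_U_kn (Q : Fin n → Fin n → ℝ) (j k l : Fin n) :
    ∑ m, L.U m * kn Q S j k l m = (∑ m, L.U m * Q j m) * S k l - (∑ m, L.U m * Q k m) * S j l
      + (∑ m, L.U m * S j m) * Q k l - (∑ m, L.U m * S k m) * Q j l := by
  simp only [Finset.sum_mul, ← Finset.sum_sub_distrib, ← Finset.sum_add_distrib, kn]
  exact Finset.sum_congr rfl fun m _ => by ring

lemma sum_U_kn_g (S : Fin n → Fin n → ℝ) (j k l : Fin n) :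
    ∑ m, L.U m * kn L.g S j k l m = L.u j * S k l - L.u k * S j l
      + (∑ m, L.U m * S j m) * L.g k l - (∑ m, L.U m * S k m) * L.g j l := by
  rw [← L.u_eq', ← L.u_eq']
  exact L.sum_U_kn _ _ _ _

lemma sum_U_uu (j : Fin n) : ∑ m, L.U m * (L.u j * L.u m) = -L.u j := by
  rw [neg_eq_neg_one_mul, ← L.unit, Finset.sum_mul]
  exact Finset.sum_congr rfl fun m _ => by ring

/-! ### Weyl tensor and its electric part -/

section Weyl

variable {C : Fin n → Fin n → Fin n → Fin n → ℝ} {E : Fin n → Fin n → ℝ}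
  (hC : IsGeneralizedCurvature C) (hCt : ∀ k l, ∑ j, ∑ m, L.h j m * C j k l m = 0)
  (hE : ∀ k l, E k l = ∑ j, ∑ m, L.U j * L.U m * C j k l m)

include hC hE in
lemma electric_symm (k l : Fin n) : E k l = E l k := by
  rw [hE, hE, Finset.sum_comm]
  exact Finset.sum_congr rfl fun a _ => Finset.sum_congr rfl fun b _ => by
    rw [hC.pair_symm b k l a, hC.antisymm_left l a b k, hC.antisymm_right a l b k]; ring

include hC hE in
lemma sum_U_electric (k : Fin n) : ∑ l, L.U l * E k l = 0 := by
  have e : ∑ l, L.U l * E k l = ∑ j, L.U j * ∑ l, ∑ m, L.U l * L.U m * C j k l m := by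
    simp only [hE, Finset.mul_sum]
    rw [Finset.sum_comm]
    exact Finset.sum_congr rfl fun a _ => Finset.sum_congr rfl fun b _ =>
      Finset.sum_congr rfl fun c _ => by ring
  rw [e]
  refine Finset.sum_eq_zero fun j _ => ?_
  have e2 : ∑ l, ∑ m, L.U l * L.U m * C j k l m = -∑ l, ∑ m, L.U l * L.U m * C j k l m := by
    conv_lhs => rw [Finset.sum_comm]
    simp only [← Finset.sum_neg_distrib]
    exact Finset.sum_congr rfl fun a _ => Finset.sum_congr rfl fun b _ => by
      rw [hC.antisymm_right]; ring
  rw [show ∑ l, ∑ m, L.U l * L.U m * C j k l m = 0 by linarith, mul_zero]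

-- The trace may be taken inside the contraction with U⊗U, where it is a trace of `C` over the
-- middle slots.
include hC hCt hE in
lemma trace_electric : ∑ k, ∑ l, L.h k l * E k l = 0 := by
  have e : ∑ k, ∑ l, L.h k l * E k l
      = ∑ j, ∑ m, ∑ k, ∑ l, L.U j * L.U m * (L.h k l * C j k l m) := by
    simp only [hE, Finset.mul_sum]
    rw [sum_swap_pairs]
    exact Finset.sum_congr rfl fun a _ => Finset.sum_congr rfl fun b _ =>
      Finset.sum_congr rfl fun c _ => Finset.sum_congr rfl fun d _ => by ring
  rw [e]
  simp only [← Finset.mul_sum]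
  refine Finset.sum_eq_zero fun j _ => Finset.sum_eq_zero fun m _ => ?_
  rw [(hC.isTotallyTraceless L.h_symm hCt).trace23, mul_zero]

include hC hCt hE in
/-- The tensor `Γ` built from a Weyl-type tensor without magnetic part. -/
lemma gamma_properties (hn : 3 < n)
    (hCU : ∀ j k l, ∑ m, L.U m * C j k l m = -L.u j * E k l + L.u k * E j l)
    {T : Fin n → Fin n → Fin n → Fin n → ℝ}
    (hT : ∀ j k l m, T j k l m = C j k l m
      + (kn L.g (fun i j => -(1 / ((n : ℝ) - 3)) * E i j) j k l m
      + kn (fun i j => L.u i * L.u j) (fun i j => -(((n : ℝ) - 2) / ((n : ℝ) - 3)) * E i j)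
          j k l m)) :
    IsGeneralizedCurvature T ∧ (∀ k l, ∑ j, ∑ m, L.h j m * T j k l m = 0) ∧
      ∀ j k l, ∑ m, L.U m * T j k l m = 0 := by
  have hn3 : (n : ℝ) - 3 ≠ 0 := by
    have : (3 : ℝ) < n := by exact_mod_cast hn
    linarith
  have hEs := L.electric_symm hC hE
  have hEU := L.sum_U_electric hC hE
  have hEt := L.trace_electric hC hCt hE
  have hEs' : ∀ (r : ℝ) (i j), r * E i j = r * E j i := fun r i j => by rw [hEs]
  have hEU' : ∀ (r : ℝ) (i), ∑ j, L.U j * (r * E i j) = 0 := fun r i => by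
    rw [← mul_zero r, ← hEU i, Finset.mul_sum]
    exact Finset.sum_congr rfl fun j _ => by ring
  have hEt' : ∀ r : ℝ, ∑ k, ∑ l, L.h k l * (r * E k l) = 0 := fun r => by
    rw [← mul_zero r, ← hEt]
    simp only [Finset.mul_sum]
    exact Finset.sum_congr rfl fun j _ => Finset.sum_congr rfl fun k _ => by ring
  refine ⟨?_, fun k l => ?_, fun j k l => ?_⟩
  · refine IsGeneralizedCurvature.congr (hC.add ((isGeneralizedCurvature_kn L.g_symm (hEs' _)).add
      (isGeneralizedCurvature_kn (fun i j => mul_comm _ _) (hEs' _)))) hT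
  -- The two products have traces -(n-2)/(n-3) E and (n-2)/(n-3) E, because E is traceless and
  -- annihilated by U.
  · simp only [hT, mul_add, Finset.sum_add_distrib]
    rw [hCt, L.trace_kn_g, L.trace_kn_u (hEs' _) (hEU' _), hEt', hEt']
    field_simp
    ring
  -- The coefficients of u_j E_{kl} - u_k E_{jl} are -1, -1/(n-3) and (n-2)/(n-3), with sum zero.
  · simp only [hT, mul_add, Finset.sum_add_distrib]
    rw [hCU, L.sum_U_kn_g, L.sum_U_kn, hEU', hEU', hEU', hEU', L.sum_U_uu, L.sum_U_uu]
    field_simp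
    ring

end Weyl

section Riemann

variable {R : Fin n → Fin n → Fin n → Fin n → ℝ} (hR : IsGeneralizedCurvature R)
  {Ric : Fin n → Fin n → ℝ} (hRic : ∀ k l, Ric k l = -∑ j, ∑ m, L.h j m * R j k l m)
  {s : ℝ} (hs : s = ∑ k, ∑ l, L.h k l * Ric k l)
  {C : Fin n → Fin n → Fin n → Fin n → ℝ}
  (hC : ∀ j k l m, C j k l m = R j k l m + kn L.g (fun i j => 1 / ((n : ℝ) - 2) * Ric i j
    - s / (2 * (((n : ℝ) - 1) * ((n : ℝ) - 2))) * L.g i j) j k l m)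

include hR hRic in
lemma ricci_symm (k l : Fin n) : Ric k l = Ric l k := by
  rw [hRic, hRic, Finset.sum_comm]
  congr 1
  exact Finset.sum_congr rfl fun a _ => Finset.sum_congr rfl fun b _ => by
    rw [L.h_symm, hR.pair_symm b k l a, hR.antisymm_left l a b k, hR.antisymm_right a l b k]; ring

-- The added factor S is a Schouten tensor; its 2 in the denominator reflects that the product of g
-- with itself counts each term twice. Its trace is s/(2(n-1)), so (n-2)S + (tr S)g = Ric cancels
-- the trace of `R`.
include hR hRic hs hC in
lemma weyl_properties (hn : 3 < n) : IsGeneralizedCurvature C ∧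
    ∀ k l, ∑ j, ∑ m, L.h j m * C j k l m = 0 := by
  have hn' : (3 : ℝ) < n := by exact_mod_cast hn
  have hn1 : (n : ℝ) - 1 ≠ 0 := by linarith
  have hn2 : (n : ℝ) - 2 ≠ 0 := by linarith
  have hsym := L.ricci_symm hR hRic
  have hS : ∀ i j, 1 / ((n : ℝ) - 2) * Ric i j
      - s / (2 * (((n : ℝ) - 1) * ((n : ℝ) - 2))) * L.g i j = 1 / ((n : ℝ) - 2) * Ric j i
      - s / (2 * (((n : ℝ) - 1) * ((n : ℝ) - 2))) * L.g j i := fun i j => by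
    rw [hsym i j, L.g_symm i j]
  refine ⟨?_, fun k l => ?_⟩
  · exact (hR.add (isGeneralizedCurvature_kn L.g_symm hS)).congr hC
  · have htr : ∑ i, ∑ j, L.h i j * (1 / ((n : ℝ) - 2) * Ric i j
        - s / (2 * (((n : ℝ) - 1) * ((n : ℝ) - 2))) * L.g i j)
        = 1 / ((n : ℝ) - 2) * s - s / (2 * (((n : ℝ) - 1) * ((n : ℝ) - 2))) * n := by
      have e : ∑ i, ∑ j, L.h i j * (1 / ((n : ℝ) - 2) * Ric i j
          - s / (2 * (((n : ℝ) - 1) * ((n : ℝ) - 2))) * L.g i j)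
          = 1 / ((n : ℝ) - 2) * (∑ i, ∑ j, L.h i j * Ric i j)
            - s / (2 * (((n : ℝ) - 1) * ((n : ℝ) - 2))) * ∑ i, ∑ j, L.h i j * L.g i j := by
        simp only [Finset.mul_sum, ← Finset.sum_sub_distrib]
        exact Finset.sum_congr rfl fun j _ => Finset.sum_congr rfl fun k _ => by ring
      rw [e, L.trace_g, ← hs]
    simp only [hC, mul_add, Finset.sum_add_distrib]
    rw [L.trace_kn_g, htr, ← neg_neg (∑ j, ∑ m, L.h j m * R j k l m), ← hRic]
    field_simp
    ring

-- Tracing `hRU` gives Ric(U) = (2-n)v + a u, so the Schouten term contracts with U to -v + γu and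
-- cancels v_j g_{kl} - v_k g_{jl}. What is left has the form u_j A_{kl} - u_k A_{jl}. A further
-- contraction shows that E is -A up to a multiple of u_k, which drops out on antisymmetrizing.
include hR hRic hs hC in
lemma sum_U_weyl (hn : 3 < n) {v : Fin n → ℝ}
    (hRU : ∀ j k l, ∑ m, L.U m * R j k l m = v j * (L.g k l + L.u k * L.u l)
      - v k * (L.g j l + L.u j * L.u l))
    {E : Fin n → Fin n → ℝ} (hE : ∀ k l, E k l = ∑ j, ∑ m, L.U j * L.U m * C j k l m)
    (j k l : Fin n) : ∑ m, L.U m * C j k l m = -L.u j * E k l + L.u k * E j l := by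
  have hn' : (3 : ℝ) < n := by exact_mod_cast hn
  have hn2 : (n : ℝ) - 2 ≠ 0 := by linarith
  set a := ∑ i, L.U i * v i with ha
  have hRicU : ∀ k, ∑ l, L.U l * Ric k l = (2 - n) * v k + a * L.u k := by
    intro k
    have e : ∑ l, L.U l * Ric k l = ∑ j, ∑ m, L.h j m * ∑ l, L.U l * R j k m l := by
      simp only [hRic, mul_neg, ← Finset.sum_neg_distrib, Finset.mul_sum]
      rw [Finset.sum_comm]
      refine Finset.sum_congr rfl fun j _ => ?_
      rw [Finset.sum_comm]
      exact Finset.sum_congr rfl fun m _ => Finset.sum_congr rfl fun l _ => by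
        rw [hR.antisymm_right j k m l]; ring
    have e2 : ∑ j, ∑ m, L.h j m * ∑ l, L.U l * R j k m l
        = ∑ j, ∑ m, L.h j m * (L.g k m * v j) + (∑ j, ∑ m, L.h j m * (L.u m * v j)) * L.u k
          - (∑ j, ∑ m, L.h j m * L.g j m) * v k
          - (∑ j, ∑ m, L.h j m * (L.u j * L.u m)) * v k := by
      simp only [hRU, Finset.sum_mul, ← Finset.sum_sub_distrib, ← Finset.sum_add_distrib]
      exact Finset.sum_congr rfl fun m _ => Finset.sum_congr rfl fun m _ => by ring
    rw [e, e2, trace_g_mul, trace_u_mul, trace_g, trace_u_mul_u, ← ha]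
    ring
  set β := s / (2 * (((n : ℝ) - 1) * ((n : ℝ) - 2))) with hβ
  set S : Fin n → Fin n → ℝ := fun i j => 1 / ((n : ℝ) - 2) * Ric i j - β * L.g i j with hS
  set γ := a / ((n : ℝ) - 2) - β with hγ
  have hSU : ∀ k, ∑ l, L.U l * S k l = -v k + γ * L.u k := by
    intro k
    have e : ∑ l, L.U l * S k l
        = 1 / ((n : ℝ) - 2) * (∑ l, L.U l * Ric k l) - β * ∑ l, L.U l * L.g k l := by
      simp only [Finset.mul_sum, ← Finset.sum_sub_distrib, hS]
      exact Finset.sum_congr rfl fun l _ => by ring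
    rw [e, hRicU, u_eq', hγ]
    field_simp
    ring
  set A : Fin n → Fin n → ℝ := fun k l => S k l + γ * L.g k l - v k * L.u l with hA
  have hCU : ∀ j k l, ∑ m, L.U m * C j k l m = L.u j * A k l - L.u k * A j l := by
    intro j k l
    simp only [hC, mul_add, Finset.sum_add_distrib]
    rw [hRU, L.sum_U_kn_g, hSU, hSU, hA]
    ring
  have hEA : ∀ k l, E k l = -A k l - L.u k * ∑ j, L.U j * A j l := by
    intro k l
    have e : E k l = ∑ j, L.U j * ∑ m, L.U m * C j k l m := by
      rw [hE]
      simp only [Finset.mul_sum]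
      exact Finset.sum_congr rfl fun j _ => Finset.sum_congr rfl fun m _ => by ring
    rw [e]
    simp only [hCU, mul_sub, Finset.sum_sub_distrib]
    rw [neg_eq_neg_one_mul (A k l), ← L.unit, Finset.sum_mul, Finset.mul_sum]
    congr 1 <;> exact Finset.sum_congr rfl fun j _ => by ring
  rw [hCU, hEA, hEA]
  ring

end Riemann

end LorentzFrame

/-! ### From a chart to a metric connection over smooth functions -/

lemma contDiffOn_det {n k : ℕ} {s : Set (Coord n)} {F : Coord n → Matrix (Fin k) (Fin k) ℝ}
    (hF : ∀ i j, ContDiffOn ℝ ∞ (fun y => F y i j) s) : ContDiffOn ℝ ∞ (fun y => (F y).det) s := by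
  simp only [Matrix.det_apply]
  refine ContDiffOn.sum fun σ _ => ContDiffOn.const_smul _ ?_
  exact contDiffOn_prod fun i _ => hF _ _

lemma contDiffOn_gInv {n : ℕ} {s : Set (Coord n)} {G : Coord n → Matrix (Fin n) (Fin n) ℝ}
    (hG : ∀ i j, ContDiffOn ℝ ∞ (fun y => G y i j) s) (hdet : ∀ y ∈ s, (G y).det ≠ 0)
    (i j : Fin n) : ContDiffOn ℝ ∞ (gInv G i j) s := by
  -- Cramer's rule expresses the inverse through determinants.
  have e : gInv G i j = fun y => ((G y).det)⁻¹ * ((G y).updateRow j (Pi.single i 1)).det := by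
    ext y
    simp [gInv, Matrix.inv_def, Matrix.adjugate_apply]
  rw [e]
  refine ((contDiffOn_det hG).inv hdet).mul (contDiffOn_det fun a b => ?_)
  by_cases h : a = j
  · subst h
    simpa using contDiffOn_const
  · simpa [Matrix.updateRow_ne h] using hG a b

lemma contDiffOn_christoffel {n : ℕ} {U : TopologicalSpace.Opens (Coord n)}
    {G : Coord n → Matrix (Fin n) (Fin n) ℝ}
    (hG : ∀ i j, ContDiffOn ℝ ∞ (fun y => G y i j) U) (hdet : ∀ y ∈ U, (G y).det ≠ 0)
    (k i j : Fin n) : ContDiffOn ℝ ∞ (christoffel G k i j) U := by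
  unfold christoffel
  refine contDiffOn_const.mul (ContDiffOn.sum fun l _ => (contDiffOn_gInv hG hdet _ _).mul ?_)
  exact ((contDiffOn_pd (hG _ _) _).add (contDiffOn_pd (hG _ _) _)).sub (contDiffOn_pd (hG _ _) _)

/-- The coordinate data of a Lorentzian metric with a torse-forming unit timelike covector field. -/
structure TorseChart (n : ℕ) where
  /-- the coordinate domain -/
  dom : TopologicalSpace.Opens (Coord n)
  /-- metric components -/
  G : Coord n → Matrix (Fin n) (Fin n) ℝ
  /-- covector components -/
  u : Fin n → Coord n → ℝ
  /-- expansion -/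
  φ : Coord n → ℝ
  contDiffOn_G : ∀ i j, ContDiffOn ℝ ∞ (fun y => G y i j) dom
  G_symm : ∀ y i j, G y i j = G y j i
  contDiffOn_u : ∀ i, ContDiffOn ℝ ∞ (u i) dom
  timelike : ∀ y ∈ dom, ∃ c : Fin n → ℝ, (∀ j, u j y = ∑ i, c i * G y i j) ∧
    ∑ i, c i * u i y = -1 ∧ ∀ w : Fin n → ℝ, ∑ i, w i * u i y = 0 → w ≠ 0 →
      0 < ∑ i, ∑ j, w i * G y i j * w j
  torse : ∀ y ∈ dom, ∀ i j, nabla1 G u i j y = φ y * (G y i j + u i y * u j y)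

namespace TorseChart

variable {n : ℕ} (X : TorseChart n)

/-- A vector in the kernel of the metric is orthogonal to u and has square zero, against positivity
on that complement. -/
lemma det_ne_zero {y : Coord n} (hy : y ∈ X.dom) : (X.G y).det ≠ 0 := by
  obtain ⟨c, hc, -, hpos⟩ := X.timelike y hy
  intro h
  obtain ⟨w, hw0, hw⟩ := Matrix.exists_mulVec_eq_zero_iff.2 h
  have hw' : ∀ i, ∑ j, X.G y i j * w j = 0 := fun i => congrFun hw i
  have h1 : ∑ i, w i * X.u i y = 0 := by
    simp only [hc, Finset.mul_sum]
    rw [Finset.sum_comm]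
    refine Finset.sum_eq_zero fun a _ => ?_
    rw [← mul_zero (c a), ← hw' a, Finset.mul_sum]
    exact Finset.sum_congr rfl fun i _ => by ring
  have h2 := hpos w h1 hw0
  simp only [mul_assoc, ← Finset.mul_sum, hw', mul_zero, Finset.sum_const_zero] at h2
  exact lt_irrefl _ h2

lemma G_mul_inv {y : Coord n} (hy : y ∈ X.dom) : X.G y * (X.G y)⁻¹ = 1 :=
  Matrix.mul_nonsing_inv _ (isUnit_iff_ne_zero.2 (X.det_ne_zero hy))

lemma raise_eq {y : Coord n} (hy : y ∈ X.dom) {c : Fin n → ℝ}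
    (hc : ∀ j, X.u j y = ∑ i, c i * X.G y i j) (i : Fin n) : raise X.G X.u i y = c i := by
  have h1 : (fun j => X.u j y) = (X.G y).mulVec c := by
    ext j
    rw [hc]
    exact Finset.sum_congr rfl fun i _ => by rw [X.G_symm, mul_comm]
  have h2 : (X.G y)⁻¹.mulVec (fun j => X.u j y) = c := by
    rw [h1, Matrix.mulVec_mulVec, mul_eq_one_comm.1 (X.G_mul_inv hy), Matrix.one_mulVec]
  exact congrFun h2 i

/-- The scalar product at a point. -/
noncomputable def frame (y : X.dom) : LorentzFrame (Fin n) where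
  g := X.G y
  h := (X.G y)⁻¹
  U i := raise X.G X.u i y
  u i := X.u i y
  g_symm := X.G_symm y
  g_mul_h := X.G_mul_inv y.2
  u_eq i := by
    obtain ⟨c, hc, -⟩ := X.timelike y y.2
    simp only [X.raise_eq y.2 hc]
    rw [hc]
    exact Finset.sum_congr rfl fun j _ => by rw [X.G_symm, mul_comm]
  unit := by
    obtain ⟨c, hc, h, -⟩ := X.timelike y y.2
    simp only [X.raise_eq y.2 hc]
    exact h
  pos := by
    obtain ⟨c, -, -, h⟩ := X.timelike y y.2
    exact h

/-- Lowering the upper index gives the Christoffel symbol of the first kind; two of these add up to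
the derivative of the metric. -/
lemma sum_christoffel_mul {y : Coord n} (hy : y ∈ X.dom) (i j k : Fin n) :
    ∑ a, christoffel X.G a i j y * X.G y a k = 1 / 2 * (pd (fun z => X.G z j k) i y
      + pd (fun z => X.G z i k) j y - pd (fun z => X.G z i j) k y) := by
  have e : ∀ l, ∑ a, (X.G y)⁻¹ a l * X.G y a k = if k = l then 1 else 0 := fun l => by
    have h := congrFun (congrFun (X.G_mul_inv hy) k) l
    rw [Matrix.mul_apply, Matrix.one_apply] at h
    rw [← h]
    exact Finset.sum_congr rfl fun a _ => by rw [X.G_symm, mul_comm]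
  have h1 : ∑ a, christoffel X.G a i j y * X.G y a k
      = ∑ l, (∑ a, (X.G y)⁻¹ a l * X.G y a k) * (1 / 2 * (pd (fun z => X.G z j l) i y
        + pd (fun z => X.G z i l) j y - pd (fun z => X.G z i j) l y)) := by
    simp only [christoffel, gInv, Finset.mul_sum, Finset.sum_mul]
    rw [Finset.sum_comm]
    exact Finset.sum_congr rfl fun l _ => Finset.sum_congr rfl fun a _ => by ring
  rw [h1]
  simp [e]

/-- The Levi-Civita connection over the algebra of smooth functions. -/
noncomputable def conn : MetricConnection (Fin n) (smoothFun X.dom) where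
  d := smoothFun.partialDeriv
  d_comm := smoothFun.partialDeriv_comm
  g := Matrix.of fun i j => smoothFun.mk (fun y => X.G y i j) (X.contDiffOn_G i j)
  h := Matrix.of fun i j => smoothFun.mk (gInv X.G i j)
    (contDiffOn_gInv X.contDiffOn_G (fun _ hy => X.det_ne_zero hy) i j)
  g_symm i j := smoothFun.ext_eval fun x => X.G_symm x i j
  g_mul_h := by
    ext1 i j
    refine smoothFun.ext_eval fun x => ?_
    have h := congrFun (congrFun (X.G_mul_inv x.2) i) j
    rw [Matrix.mul_apply] at h ⊢
    rw [map_sum]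
    simp only [map_mul, Matrix.of_apply, smoothFun.eval_mk]
    refine h.trans ?_
    rw [Matrix.one_apply, Matrix.one_apply]
    split_ifs <;> simp
  A i := Matrix.of fun k j => smoothFun.mk (christoffel X.G k i j)
    (contDiffOn_christoffel X.contDiffOn_G (fun _ hy => X.det_ne_zero hy) k i j)
  torsion i j k := smoothFun.ext_eval fun x => by
    simp only [Matrix.of_apply, smoothFun.eval_mk, christoffel]
    have e : (fun z => X.G z i j) = fun z => X.G z j i := funext fun z => X.G_symm z i j
    congr 1
    refine Finset.sum_congr rfl fun l _ => ?_
    rw [e, add_comm (pd (fun z => X.G z j l) i x)]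
  metric i := by
    ext1 j k
    refine smoothFun.ext_eval fun x => ?_
    rw [Matrix.map_apply, Matrix.add_apply, Matrix.mul_apply, Matrix.mul_apply, map_add, map_sum,
      map_sum]
    simp only [map_mul, Matrix.of_apply, Matrix.transpose_apply, smoothFun.eval_mk]
    rw [smoothFun.eval_partialDeriv (F := fun y => X.G y j k) fun z => rfl,
      X.sum_christoffel_mul x.2]
    have h2 : ∑ a, X.G x j a * christoffel X.G a i k x
        = ∑ a, christoffel X.G a i k x * X.G x a j :=
      Finset.sum_congr rfl fun a _ => by rw [X.G_symm, mul_comm]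
    rw [h2, X.sum_christoffel_mul x.2]
    have e : (fun z => X.G z k j) = fun z => X.G z j k := funext fun z => X.G_symm z k j
    rw [e]
    ring

/-- The covector field as smooth functions. -/
noncomputable def uS (i : Fin n) : smoothFun X.dom := smoothFun.mk (X.u i) (X.contDiffOn_u i)

variable (x : X.dom)

@[simp] lemma eval_uS (i : Fin n) : smoothFun.eval x (X.uS i) = X.u i x := rfl

@[simp] lemma eval_g (i j : Fin n) : smoothFun.eval x (X.conn.g i j) = X.G x i j := rfl

@[simp] lemma eval_h (i j : Fin n) : smoothFun.eval x (X.conn.h i j) = gInv X.G i j x := rfl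

@[simp] lemma eval_A (i j k : Fin n) :
    smoothFun.eval x (X.conn.A i j k) = christoffel X.G j i k x := rfl

lemma eval_d {F : Coord n → ℝ} {f : smoothFun X.dom}
    (h : ∀ x : X.dom, F x = smoothFun.eval x f) (i : Fin n) :
    smoothFun.eval x (X.conn.d i f) = pd F i x :=
  smoothFun.eval_partialDeriv h i x

@[simp] lemma eval_sharp (i : Fin n) :
    smoothFun.eval x (X.conn.sharp X.uS i) = raise X.G X.u i x := by
  simp [MetricConnection.sharp, raise]

lemma eval_nab1 (i j : Fin n) :
    smoothFun.eval x (X.conn.nab1 X.uS i j) = nabla1 X.G X.u i j x := by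
  simp only [MetricConnection.nab1, nabla1, map_sub, map_sum, map_mul, eval_A, eval_uS]
  rw [X.eval_d (F := X.u j) x fun z => rfl]

lemma eval_nab4 {T : Fin n → Fin n → Fin n → Fin n → smoothFun X.dom}
    {F : Fin n → Fin n → Fin n → Fin n → Coord n → ℝ}
    (h : ∀ (x : X.dom) j k l m, F j k l m x = smoothFun.eval x (T j k l m)) (p j k l m : Fin n) :
    smoothFun.eval x (X.conn.nab4 T p j k l m) = nabla4 X.G F p j k l m x := by
  simp only [MetricConnection.nab4, nabla4, map_sub, map_sum, map_mul, map_add, eval_A, ← h]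
  rw [X.eval_d (F := F j k l m) x fun z => h z j k l m]

lemma eval_curv (j k l m : Fin n) :
    smoothFun.eval x (X.conn.curv j k m l) = riemannUp X.G j k l m x := by
  simp only [MetricConnection.curv, riemannUp, Matrix.add_apply, Matrix.sub_apply,
    Matrix.map_apply, Matrix.mul_apply, map_add, map_sub, map_sum, map_mul, eval_A]
  rw [X.eval_d (F := christoffel X.G m j l) x fun z => rfl,
    X.eval_d (F := christoffel X.G m k l) x fun z => rfl, Finset.sum_sub_distrib, add_sub_assoc]
  congr 2 <;> exact Finset.sum_congr rfl fun p _ => mul_comm _ _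

lemma eval_riem (j k l m : Fin n) :
    smoothFun.eval x (X.conn.riem j k l m) = riemann X.G j k l m x := by
  simp only [MetricConnection.riem, riemann, map_sum, map_mul, eval_g, eval_curv]

lemma isGeneralizedCurvature_riemann :
    IsGeneralizedCurvature fun j k l m => riemann X.G j k l m x where
  antisymm_left j k l m := by
    rw [← eval_riem, ← eval_riem, ← map_neg, ← X.conn.riem_antisymm_left]
  antisymm_right j k l m := by
    rw [← eval_riem, ← eval_riem, ← map_neg, ← X.conn.riem_antisymm_right]
  pair_symm j k l m := by rw [← eval_riem, ← eval_riem, ← X.conn.riem_pair_symm]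
  bianchi j k l m := by
    rw [← eval_riem, ← eval_riem, ← eval_riem, ← map_add, ← map_add, X.conn.riem_bianchi, map_zero]

lemma ricci_eq (k l : Fin n) :
    ricci X.G k l x = -∑ j, ∑ m, (X.frame x).h j m * riemann X.G j k l m x := by
  have e : ∀ j, ∑ m, (X.frame x).h j m * riemann X.G j k l m x = riemannUp X.G j k l j x := by
    intro j
    have h1 : ∑ m, (X.frame x).h j m * riemann X.G j k l m x
        = ∑ p, riemannUp X.G j k l p x * ∑ m, (X.frame x).h j m * (X.frame x).g p m := by
      simp only [riemann, Finset.mul_sum]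
      rw [Finset.sum_comm]
      exact Finset.sum_congr rfl fun p _ => Finset.sum_congr rfl fun m _ => by
        simp only [frame]; ring
    rw [h1]
    simp [LorentzFrame.sum_h_mul_g]
  simp only [e, ricci]

lemma weyl_eq (j k l m : Fin n) : weyl X.G j k l m x = riemann X.G j k l m x
    + kn (X.frame x).g (fun i j => 1 / ((n : ℝ) - 2) * ricci X.G i j x
      - scalarCurv X.G x / (2 * (((n : ℝ) - 1) * ((n : ℝ) - 2))) * (X.frame x).g i j) j k l m := by
  rw [show scalarCurv X.G x / (2 * (((n : ℝ) - 1) * ((n : ℝ) - 2)))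
    = scalarCurv X.G x / (((n : ℝ) - 1) * ((n : ℝ) - 2)) / 2 by rw [mul_comm 2, div_mul_eq_div_div]]
  simp only [weyl, kn, frame]
  ring

lemma gammaTensor_eq (j k l m : Fin n) : gammaTensor X.G X.u j k l m x = weyl X.G j k l m x
    + (kn (X.frame x).g (fun i j => -(1 / ((n : ℝ) - 3)) * electric X.G X.u i j x) j k l m
      + kn (fun i j => (X.frame x).u i * (X.frame x).u j)
        (fun i j => -(((n : ℝ) - 2) / ((n : ℝ) - 3)) * electric X.G X.u i j x) j k l m) := by
  simp only [gammaTensor, kn, frame]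
  ring

end TorseChart

/-! ### The tensor Γ on a chart and its transport along u -/

namespace TorseChart

variable {n : ℕ} (X : TorseChart n)

/-- The expansion as a smooth function: up to `n - 1` it is the divergence of `u`. -/
noncomputable def φS : smoothFun X.dom :=
  (1 / ((n : ℝ) - 1)) • ∑ i, ∑ j, X.conn.h i j * X.conn.nab1 X.uS i j

variable (x : X.dom)

/-- Trace ∇u = φ(g + u⊗u): the trace on the right is φ(n - 1). This makes φ smooth on the chart,
which is not assumed. -/
lemma eval_φS (hn : 3 < n) : smoothFun.eval x X.φS = X.φ x := by
  have hn1 : (n : ℝ) - 1 ≠ 0 := by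
    have : (3 : ℝ) < n := by exact_mod_cast hn
    linarith
  have h1 : ∑ i, ∑ j, gInv X.G i j x * nabla1 X.G X.u i j x = X.φ x * (n - 1) := by
    have e : ∑ i, ∑ j, gInv X.G i j x * nabla1 X.G X.u i j x
        = X.φ x * (∑ i, ∑ j, (X.frame x).h i j * (X.frame x).g i j
          + ∑ i, ∑ j, (X.frame x).h i j * ((X.frame x).u i * (X.frame x).u j)) := by
      simp only [X.torse x x.2, Finset.mul_sum, ← Finset.sum_add_distrib]
      exact Finset.sum_congr rfl fun i _ => Finset.sum_congr rfl fun j _ => by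
        simp only [frame, gInv]; ring
    rw [e, LorentzFrame.trace_g, LorentzFrame.trace_u_mul_u]
    ring
  rw [φS, map_smul, map_sum]
  simp only [map_sum, map_mul, eval_h, eval_nab1, smul_eq_mul]
  rw [h1]
  field_simp

lemma nab1_uS (hn : 3 < n) (i j : Fin n) :
    X.conn.nab1 X.uS i j = X.φS * X.conn.proj X.uS i j := by
  refine smoothFun.ext_eval fun x => ?_
  rw [eval_nab1, X.torse x x.2, map_mul, X.eval_φS x hn]
  simp [MetricConnection.proj]

lemma sum_raise_riemann (hn : 3 < n) (j k l : Fin n) :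
    ∑ m, (X.frame x).U m * riemann X.G j k l m x
      = smoothFun.eval x (X.conn.d j X.φS - X.φS ^ 2 * X.uS j)
          * ((X.frame x).g k l + (X.frame x).u k * (X.frame x).u l)
        - smoothFun.eval x (X.conn.d k X.φS - X.φS ^ 2 * X.uS k)
          * ((X.frame x).g j l + (X.frame x).u j * (X.frame x).u l) := by
  have h := congrArg (smoothFun.eval x) (X.conn.sum_sharp_riem (X.nab1_uS hn) j k l)
  rw [map_sum] at h
  simp only [map_mul, eval_sharp, eval_riem] at h
  refine h.trans ?_
  rw [map_sub, map_mul, map_mul]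
  simp only [MetricConnection.proj, map_add, map_mul, eval_g, eval_uS]
  rfl

lemma weyl_properties (hn : 3 < n) : IsGeneralizedCurvature (fun j k l m => weyl X.G j k l m x) ∧
    ∀ k l, ∑ j, ∑ m, (X.frame x).h j m * weyl X.G j k l m x = 0 :=
  (X.frame x).weyl_properties (X.isGeneralizedCurvature_riemann x) (X.ricci_eq x) rfl
    (X.weyl_eq x) hn

lemma gammaTensor_properties (hn : 3 < n) :
    IsGeneralizedCurvature (fun j k l m => gammaTensor X.G X.u j k l m x) ∧
      (∀ k l, ∑ j, ∑ m, (X.frame x).h j m * gammaTensor X.G X.u j k l m x = 0) ∧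
      ∀ j k l, ∑ m, (X.frame x).U m * gammaTensor X.G X.u j k l m x = 0 := by
  refine (X.frame x).gamma_properties (X.weyl_properties x hn).1 (X.weyl_properties x hn).2
    (E := fun k l => electric X.G X.u k l x) (fun k l => rfl) hn ?_ (X.gammaTensor_eq x)
  exact (X.frame x).sum_U_weyl (X.isGeneralizedCurvature_riemann x) (X.ricci_eq x) rfl
    (X.weyl_eq x) hn (v := fun j => smoothFun.eval x (X.conn.d j X.φS - X.φS ^ 2 * X.uS j))
    (X.sum_raise_riemann x hn) (fun k l => rfl)

/-! ### Smooth versions of the tensors -/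

/-- Ricci tensor as smooth functions. -/
noncomputable def ricciS (k l : Fin n) : smoothFun X.dom :=
  -∑ j, ∑ m, X.conn.h j m * X.conn.riem j k l m

/-- Coefficient tensor of the Weyl tensor as smooth functions. -/
noncomputable def schoutenS (k l : Fin n) : smoothFun X.dom :=
  (1 / ((n : ℝ) - 2)) • X.ricciS k l - (1 / (2 * (((n : ℝ) - 1) * ((n : ℝ) - 2)))) •
    ((∑ i, ∑ j, X.conn.h i j * X.ricciS i j) * X.conn.g k l)

/-- Electric part of the Weyl tensor as smooth functions. -/
noncomputable def electricS (k l : Fin n) : smoothFun X.dom :=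
  ∑ j, ∑ m, X.conn.sharp X.uS j * X.conn.sharp X.uS m
    * (X.conn.riem j k l m + kn (fun i j => X.conn.g i j) X.schoutenS j k l m)

/-- The tensor `Γ` as smooth functions. -/
noncomputable def gammaS (j k l m : Fin n) : smoothFun X.dom :=
  X.conn.riem j k l m + (kn (fun i j => X.conn.g i j)
      (fun i j => X.schoutenS i j - (1 / ((n : ℝ) - 3)) • X.electricS i j) j k l m
    + kn (fun i j => X.uS i * X.uS j)
      (fun i j => -((((n : ℝ) - 2) / ((n : ℝ) - 3)) • X.electricS i j)) j k l m)

lemma eval_ricciS (k l : Fin n) : smoothFun.eval x (X.ricciS k l) = ricci X.G k l x := by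
  rw [ricci_eq, ricciS, map_neg, map_sum]
  simp only [map_sum, map_mul, eval_h, eval_riem]
  rfl

lemma eval_schoutenS (k l : Fin n) : smoothFun.eval x (X.schoutenS k l)
    = 1 / ((n : ℝ) - 2) * ricci X.G k l x
      - scalarCurv X.G x / (2 * (((n : ℝ) - 1) * ((n : ℝ) - 2))) * X.G x k l := by
  rw [schoutenS, map_sub, map_smul, map_smul, map_mul, map_sum]
  simp only [map_sum, map_mul, eval_h, eval_g, eval_ricciS, smul_eq_mul, scalarCurv]
  ring

lemma eval_weylS (j k l m : Fin n) : smoothFun.eval x (X.conn.riem j k l m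
    + kn (fun i j => X.conn.g i j) X.schoutenS j k l m) = weyl X.G j k l m x := by
  rw [weyl_eq, map_add, eval_riem]
  simp only [kn, map_add, map_sub, map_mul, eval_g, eval_schoutenS]
  rfl

lemma eval_electricS (k l : Fin n) :
    smoothFun.eval x (X.electricS k l) = electric X.G X.u k l x := by
  rw [electricS, map_sum]
  simp only [map_sum, map_mul, eval_weylS, eval_sharp, electric]

lemma eval_gammaS (j k l m : Fin n) :
    smoothFun.eval x (X.gammaS j k l m) = gammaTensor X.G X.u j k l m x := by
  rw [gammaTensor_eq, ← eval_weylS, gammaS]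
  simp only [kn, map_add, map_sub, map_mul, map_neg, map_smul, eval_g, eval_uS, eval_electricS,
    smul_eq_mul, frame]
  ring

lemma gammaS_antisymm (hn : 3 < n) (j k l m : Fin n) : X.gammaS j k l m = -X.gammaS k j l m :=
  smoothFun.ext_eval fun x => by
    rw [map_neg, eval_gammaS, eval_gammaS]
    exact (X.gammaTensor_properties x hn).1.antisymm_left j k l m

lemma gammaS_pair_symm (hn : 3 < n) (j k l m : Fin n) : X.gammaS j k l m = X.gammaS l m j k :=
  smoothFun.ext_eval fun x => by
    rw [eval_gammaS, eval_gammaS]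
    exact (X.gammaTensor_properties x hn).1.pair_symm j k l m

lemma sum_sharp_gammaS (hn : 3 < n) (j k l : Fin n) :
    ∑ m, X.conn.sharp X.uS m * X.gammaS j k l m = 0 :=
  smoothFun.ext_eval fun x => by
    rw [map_sum, map_zero]
    simp only [map_mul, eval_sharp, eval_gammaS]
    exact (X.gammaTensor_properties x hn).2.2 j k l

lemma trace_gammaS (hn : 3 < n) (k l : Fin n) :
    ∑ j, ∑ m, X.conn.h j m * X.gammaS j k l m = 0 :=
  smoothFun.ext_eval fun x => by
    rw [map_sum, map_zero]
    simp only [map_sum, map_mul, eval_h, eval_gammaS]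
    exact (X.gammaTensor_properties x hn).2.1 k l

/-- The derivative of `Γ` along `u`, corrected by the expansion. -/
noncomputable def transportS (j k l m : Fin n) : smoothFun X.dom :=
  ∑ p, X.conn.sharp X.uS p * X.conn.nab4 X.gammaS p j k l m + 2 * X.φS * X.gammaS j k l m

/-- The transported tensor is of trace type and inherits from Γ the antisymmetry, the pair symmetry,
the vanishing contraction with u and the vanishing trace. Evaluation at a point makes the positivity
argument over ℝ available. -/
lemma eval_transportS_eq_zero (hn : 3 < n) (j k l m : Fin n) :
    smoothFun.eval x (X.transportS j k l m) = 0 := by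
  have htt := X.conn.isTraceType_nab4 (X.nab1_uS hn) _ _ (T := X.gammaS) fun j k l m => rfl
  refine (X.frame x).eq_zero_of_isTraceType
    (T := fun j k l m => smoothFun.eval x (X.transportS j k l m))
    (htt.map (smoothFun.eval x).toRingHom) (fun j k l m => ?_) (fun j k l m => ?_)
    (fun j k l => ?_) (fun k l => ?_) j k l m
  · rw [← map_neg]
    congr 1
    have e : ∑ p, X.conn.sharp X.uS p * X.conn.nab4 X.gammaS p j k l m
        = -∑ p, X.conn.sharp X.uS p * X.conn.nab4 X.gammaS p k j l m := by
      rw [← Finset.sum_neg_distrib]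
      exact Finset.sum_congr rfl fun p _ => by
        rw [X.conn.nab4_antisymm (X.gammaS_antisymm hn) p j]
        ring
    rw [transportS, transportS, e, X.gammaS_antisymm hn j]
    ring
  · congr 1
    rw [transportS, transportS, X.gammaS_pair_symm hn j]
    congr 1
    exact Finset.sum_congr rfl fun p _ => by
      rw [X.conn.nab4_pair_symm (X.gammaS_pair_symm hn) p j]
  · have h : ∑ m, X.conn.sharp X.uS m * X.transportS j k l m = 0 := by
      simp only [transportS, mul_add, Finset.sum_add_distrib]
      rw [X.conn.sum_sharp_nab4 (X.nab1_uS hn) (X.sum_sharp_gammaS hn), zero_add,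
        ← mul_zero (2 * X.φS), ← X.sum_sharp_gammaS hn j k l, Finset.mul_sum]
      exact Finset.sum_congr rfl fun m _ => by ring
    have h' := congrArg (smoothFun.eval x) h
    rw [map_sum, map_zero] at h'
    simp only [map_mul, eval_sharp] at h'
    exact h'
  · have h : ∑ j, ∑ m, X.conn.h j m * X.transportS j k l m = 0 := by
      simp only [transportS, mul_add, Finset.sum_add_distrib]
      rw [X.conn.trace_sum_sharp_nab4 (X.trace_gammaS hn), zero_add,
        ← mul_zero (2 * X.φS), ← X.trace_gammaS hn k l]
      simp only [Finset.mul_sum]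
      exact Finset.sum_congr rfl fun j _ => Finset.sum_congr rfl fun m _ => by ring
    have h' := congrArg (smoothFun.eval x) h
    rw [map_sum, map_zero] at h'
    simp only [map_sum, map_mul, eval_h] at h'
    exact h'

lemma sum_raise_nabla4_gammaTensor (hn : 3 < n) (j k l m : Fin n) :
    ∑ p, raise X.G X.u p x * nabla4 X.G (gammaTensor X.G X.u) p j k l m x
      = -2 * X.φ x * gammaTensor X.G X.u j k l m x := by
  have h := X.eval_transportS_eq_zero x hn j k l m
  rw [transportS, map_add, map_sum, map_mul, map_mul, X.eval_φS x hn, eval_gammaS] at h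
  simp only [map_mul, eval_sharp,
    X.eval_nab4 x (F := gammaTensor X.G X.u) fun x j k l m => (X.eval_gammaS x j k l m).symm] at h
  have h2 : smoothFun.eval x 2 = 2 := map_ofNat _ 2
  rw [h2] at h
  linarith

lemma gammaTensor_eq_zero_of_dim_four (X : TorseChart 4) (x : X.dom) (j k l m : Fin 4) :
    gammaTensor X.G X.u j k l m x = 0 :=
  (X.frame x).eq_zero_of_dim_four (T := fun j k l m => gammaTensor X.G X.u j k l m x)
    (X.gammaTensor_properties x (by norm_num)).1.antisymm_left
    (X.gammaTensor_properties x (by norm_num)).1.pair_symm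
    (X.gammaTensor_properties x (by norm_num)).2.2
    (X.gammaTensor_properties x (by norm_num)).2.1 j k l m

end TorseChart

end Spacetime

/-! ### The theorem on the manifold, chart by chart -/

theorem theorem2 {n : ℕ} (hn : 3 < n)
    {M : Type*} [TopologicalSpace M] [ChartedSpace (Spacetime.Coord n) M] [IsManifold (𝓡 n) ∞ M]
    (g : Spacetime.LorentzMetric (Spacetime.Coord n) M)
    (u : ∀ x : M, TangentSpace (𝓡 n) x)
    (hu_smooth : ContMDiff (𝓡 n) (𝓡 n).tangent ∞
      (fun x => (⟨x, u x⟩ : TangentBundle (𝓡 n) M)))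
    (hu_unit : ∀ x : M, g.val x (u x) (u x) = -1)
    (φ : M → ℝ)
    (hu_torse : ∀ e ∈ IsManifold.maximalAtlas (𝓡 n) ∞ M, ∀ y ∈ e.target, ∀ i j : Fin n,
      Spacetime.nabla1 (g.comp e) (g.lower u e) i j y
        = φ (e.symm y) * (g.comp e y i j + g.lower u e i y * g.lower u e j y)) :
    ∀ e ∈ IsManifold.maximalAtlas (𝓡 n) ∞ M, ∀ y ∈ e.target,
      Spacetime.IsGeneralizedCurvature
          (fun j k l m => Spacetime.gammaTensor (g.comp e) (g.lower u e) j k l m y) ∧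
      Spacetime.IsTotallyTraceless (fun a b => Spacetime.gInv (g.comp e) a b y)
          (fun j k l m => Spacetime.gammaTensor (g.comp e) (g.lower u e) j k l m y) ∧
      (∀ j k l : Fin n,
        ∑ m, Spacetime.raise (g.comp e) (g.lower u e) m y
          * Spacetime.gammaTensor (g.comp e) (g.lower u e) j k l m y = 0) ∧
      (∀ j k l m : Fin n,
        ∑ p, Spacetime.raise (g.comp e) (g.lower u e) p y
          * Spacetime.nabla4 (g.comp e) (Spacetime.gammaTensor (g.comp e) (g.lower u e)) p j k l m y
        = -2 * φ (e.symm y) * Spacetime.gammaTensor (g.comp e) (g.lower u e) j k l m y) ∧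
      (n = 4 → ∀ j k l m : Fin n,
        Spacetime.gammaTensor (g.comp e) (g.lower u e) j k l m y = 0) := by
  intro e he y hy
  let X : Spacetime.TorseChart n :=
    { dom := ⟨e.target, e.open_target⟩
      G := g.comp e
      u := g.lower u e
      φ := fun y => φ (e.symm y)
      contDiffOn_G := g.contDiffOn_comp he
      G_symm := g.comp_symm e
      contDiffOn_u := g.contDiffOn_lower he hu_smooth
      timelike := fun y hy => g.exists_components he hu_unit hy
      torse := hu_torse e he }
  let x : X.dom := ⟨y, hy⟩
  have hX := X.gammaTensor_properties x hn
  refine ⟨hX.1, hX.1.isTotallyTraceless (X.frame x).h_symm hX.2.1, hX.2.2,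
    X.sum_raise_nabla4_gammaTensor x hn, ?_⟩
  rintro h4
  subst h4
  exact X.gammaTensor_eq_zero_of_dim_four x
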